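/- Let $\mathfrak g$ be a finite-dimensional real simple Lie algebra with Cartan involution $\tau$ (the data of a coset model $G/H$, with $\mathfrak g=\mathrm{Lie}(G)$ and $H$ maximal compact, $\mathrm{Lie}(H)$ being the fixed points of $\tau$), and let $\mathfrak a$ be a maximal abelian subspace of $\mathfrak p=\{x\mid\tau x=-x\}$, of dimension $r$ (the real rank). Let $\bar B\subset\mathfrak a^*$ be the set of restricted roots of $\mathfrak g$ with respect to $\mathfrak a$; assume that $\mathfrak g$ is noncompact, so that $\bar B\neq\emptyset$. Fix a system of simple roots $\sigma_1,\dots,\sigma_r$ of $\bar B$, and let $\theta$ be the highest root. Let $\phi^1,\dots,\phi^r$ (the dilatons) be linear coordinates on $\mathfrak a$ in which some multiple of the Killing form is $\sum_\alpha (d\phi^\alpha)^2$. On the space $\mathbb R^2\times\mathfrak a$ of the scale factors $(\beta^1,\beta^2,\phi)$ take the metric $\sum_i(d\beta^i)^2-(\sum_i d\beta^i)^2+\sum_\alpha(d\phi^\alpha)^2$; the inverse metric on linear forms is $$(f|g)=\sum_{i}\partial_i f\,\partial_i g-\Big(\sum_i\partial_i f\Big)\Big(\sum_i\partial_i g\Big)+\sum_\alpha\partial_\alpha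 f\,\partial_\alpha g .$$ Assume the normalization $(\theta|\theta)=2$. The billiard of 3-dimensional gravity coupled to the coset model is the set of points at which all the wall forms $\lambda(\phi)$ and $\beta^i-\lambda(\phi)$ ($i=1,2$; $\lambda\in\bar B$ positive) and $\beta^2-\beta^1$ are $\ge 0$. **Theorem.** The billiard is the chamber defined by the inequalities $\alpha_i\ge 0$ for the $r+2$ dominant wall forms $\alpha_i$: $\sigma_1,\dots,\sigma_r$, $\beta^1-\theta$ and $\beta^2-\beta^1$. Moreover: (i) If $\bar B$ is not of $bc$-type, the billiard is the fundamental Weyl chamber of the overextension $F^{\wedge\wedge}$ of the maximal split subalgebra $F$ of $\mathfrak g$. (ii) If $\bar B$ is of type $bc_r$, the billiard is the fundamental Weyl chamber of the Lorentzian extension $A_{2r}^{(2)\wedge}$ of the twisted affine algebra $A_{2r}^{(2)}$. Here the maximal split subalgebra $F$ is a semisimple subalgebra of $\mathfrak g$ having $\mathfrak a$ as a splitting Cartan subalgebra and the indivisible restricted roots ($\lambda\in\bar B$ with $\lambda/2\notin\bar B$) as its roots. The root system $bc_r$ is the union of $b_r=\{\pm e_i\}\cup\{\pm e_i\pm e_j\mid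 i\ne j\}$ and $c_r=\{\pm2e_i\}\cup\{\pm e_i\pm e_j\mid i\neq j\}$. Kac–Moody algebras are split real, given by Chevalley–Serre generators and relations. The Lorentzian extension adjoins to the Dynkin diagram of an affine algebra one node, attached with a single line: to the affine root $\alpha_0=\delta-\theta_F$ ($\theta_F$ the highest root of $F$) of the untwisted affine extension $F^\wedge$, giving $F^{\wedge\wedge}$; to the unique root with mark $1$ (the longest one) of $A_{2r}^{(2)}$, giving $A_{2r}^{(2)\wedge}$. That a chamber with wall forms $\alpha_i$ is the fundamental Weyl chamber of a Kac–Moody algebra with Cartan matrix $A$, Chevalley generators $H_i,E_i,F_i$ and Cartan subalgebra $\mathfrak h=\mathrm{span}(H_i)$ means: after a suitable numbering, $A_{ij}=2(\alpha_i|\alpha_j)/(\alpha_i|\alpha_i)$, and some linear isomorphism of the space of scale factors onto $\mathfrak h$ carries the vectors $2\alpha_i^\sharp/(\alpha_i|\alpha_i)$ to the simple coroots $H_i$, the forms $\alpha_i$ to the simple roots (given by $[h,E_i]=\alpha_i(h)E_i$, $E_i\ne0$), and the chamber onto the set of $h\in\mathfrak h$ on which all simple roots are $\ge 0$. -/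

import Mathlib

open Module

noncomputable section

/-! ## Kac–Moody algebras and their fundamental Weyl chambers -/

namespace KacMoody

variable {J : Type*} [DecidableEq J]

/-- The split real Kac–Moody algebra with (nonsingular) generalized Cartan matrix `A`, given by the
Chevalley–Serre generators `Hᵢ`, `Eᵢ`, `Fᵢ` and relations over the reals. The convention is
`⁅Hᵢ, Eⱼ⁆ = A i j • Eⱼ`, i.e. `A i j` is the value of the simple root `αⱼ` on the simple coroot
`αᵢ^∨ = Hᵢ`. -/
abbrev Algebra (A : Matrix J J ℤ) : Type _ := Matrix.ToLieAlgebra ℝ A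

/-- The simple coroot `Hᵢ`. -/
def genH (A : Matrix J J ℤ) (i : J) : Algebra A :=
  LieSubmodule.Quotient.mk (N := CartanMatrix.Relations.toIdeal ℝ A)
    (FreeLieAlgebra.of ℝ (CartanMatrix.Generators.H i))

/-- The raising Chevalley generator `Eᵢ`, a root vector for the simple root `αᵢ`. -/
def genE (A : Matrix J J ℤ) (i : J) : Algebra A :=
  LieSubmodule.Quotient.mk (N := CartanMatrix.Relations.toIdeal ℝ A)
    (FreeLieAlgebra.of ℝ (CartanMatrix.Generators.E i))

/-- The (real, split) Cartan subalgebra, spanned by the simple coroots. -/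
def cartan (A : Matrix J J ℤ) : Submodule ℝ (Algebra A) :=
  Submodule.span ℝ (Set.range (genH A))

/-- The fundamental Weyl chamber: the set of `h` in the Cartan subalgebra on which every simple root
is nonnegative (the value of the simple root `αⱼ` on `h` being the number `a` with
`⁅h, Eⱼ⁆ = a • Eⱼ`). -/
def fundamentalWeylChamber (A : Matrix J J ℤ) : Set (cartan A) :=
  {h | ∀ j, ∃ a : ℝ, 0 ≤ a ∧ ⁅(h : Algebra A), genE A j⁆ = a • genE A j}

/-- The Lorentzian extension of a generalized Cartan matrix at the node `j₀`: one more node (the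
overextended root, index `none`) is attached to `j₀` with a single line. -/
def lorentzianExtension (A : Matrix J J ℤ) (j₀ : J) : Matrix (Option J) (Option J) ℤ
  | some i, some j => A i j
  | none, none => 2
  | none, some j => if j = j₀ then -1 else 0
  | some i, none => if i = j₀ then -1 else 0

end KacMoody

/-- `η` is (the index of) the highest root of a root system relative to the base `b`. -/
def RootPairing.Base.IsHighestRoot {ι R M N : Type*} [CommRing R] [AddCommGroup M] [Module R M]
    [AddCommGroup N] [Module R N] {P : RootPairing ι R M N} (b : P.Base) (η : ι) : Prop :=
  ∀ i, P.root η - P.root i ∈ AddSubmonoid.closure (P.root '' b.support)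

/-- The Cartan matrix of the untwisted affine extension: the affine root `α₀ = δ - θ`, with `θ` the
highest root, is adjoined (index `none`). The entries are `a i j = ⟨αⱼ, αᵢ^∨⟩`, where `δ` pairs to
zero with every coroot and `α₀^∨` pairs with the roots as `-θ^∨` does. -/
def RootPairing.Base.untwistedAffine {ι R M N : Type*} [CommRing R] [CharZero R]
    [AddCommGroup M] [Module R M] [AddCommGroup N] [Module R N] {P : RootPairing ι R M N}
    [P.IsCrystallographic] (b : P.Base) (η : ι) :
    Matrix (Option b.support) (Option b.support) ℤ
  | some i, some j => P.pairingIn ℤ j i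
  | none, none => 2
  | none, some j => - P.pairingIn ℤ j η
  | some i, none => - P.pairingIn ℤ η i

/-- The Cartan matrix of the twisted affine algebra `A_{2n}^{(2)}` (`n ≥ 1`), nodes `0, …, n`. Node
`0` is the shortest root, node `n` the longest one, which is the unique one with mark `1`:
for `n = 1` the matrix is `!![2, -4; -1, 2]`, and for `n ≥ 2` the diagram is the chain
`α₀ ⇐ α₁ - ⋯ - α_{n-1} ⇐ αₙ`. -/
def twistedA2Even (n : ℕ) : Matrix (Fin (n + 1)) (Fin (n + 1)) ℤ := fun i j =>
  if i = j then 2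
  else if (i : ℕ) + 1 = j then
    -((if (i : ℕ) = 0 then 2 else 1) * (if (j : ℕ) = n then 2 else 1))
  else if (j : ℕ) + 1 = i then -1
  else 0

/-! ## The nonreduced root systems `bc_n` -/

/-- The roots `±eᵢ ± eⱼ` (`i ≠ j`) common to `b_n` and `c_n`. -/
def dRoots (n : ℕ) : Set (Fin n → ℝ) :=
  {v | ∃ i j, i ≠ j ∧ ∃ s ∈ ({1, -1} : Set ℝ), ∃ t ∈ ({1, -1} : Set ℝ),
    v = Pi.single i s + Pi.single j t}

/-- The root system `b_n`. -/
def bRoots (n : ℕ) : Set (Fin n → ℝ) :=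
  {v | ∃ i, v = Pi.single i 1 ∨ v = Pi.single i (-1)} ∪ dRoots n

/-- The root system `c_n`. -/
def cRoots (n : ℕ) : Set (Fin n → ℝ) :=
  {v | ∃ i, v = Pi.single i 2 ∨ v = Pi.single i (-2)} ∪ dRoots n

/-- `R` is a root system of type `bc_n`: it is carried onto the union of `b_n` and `c_n` by a linear
isomorphism. -/
def IsOfBCType {V : Type*} [AddCommGroup V] [Module ℝ V] (R : Set V) (n : ℕ) : Prop :=
  ∃ f : V ≃ₗ[ℝ] (Fin n → ℝ), f '' R = bRoots n ∪ cRoots n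

/-! ## Real Lie algebras and restricted roots -/

section Restricted

variable {𝔤 : Type*} [LieRing 𝔤] [LieAlgebra ℝ 𝔤]

/-- `τ` is a Cartan involution: `τ² = 1` and `-κ(x, τ y)` is positive definite, `κ` being the
Killing form. Its fixed points form the Lie algebra of a maximal compact subgroup `H`. -/
def IsCartanInvolution (τ : 𝔤 ≃ₗ⁅ℝ⁆ 𝔤) : Prop :=
  (∀ x, τ (τ x) = x) ∧ ∀ x, x ≠ 0 → 0 < -killingForm ℝ 𝔤 x (τ x)

/-- `𝔞` is a maximal abelian subspace of the noncompact part `𝔭 = {x | τ x = -x}`, i.e. the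
noncompact part of a maximally noncompact (`τ`-stable) Cartan subalgebra. -/
def IsMaximalAbelianNoncompact (τ : 𝔤 ≃ₗ⁅ℝ⁆ 𝔤) (𝔞 : Submodule ℝ 𝔤) : Prop :=
  (∀ x ∈ 𝔞, τ x = -x) ∧ (∀ x ∈ 𝔞, ∀ y ∈ 𝔞, ⁅x, y⁆ = 0) ∧
    ∀ x, τ x = -x → (∀ y ∈ 𝔞, ⁅x, y⁆ = 0) → x ∈ 𝔞

/-- The simultaneous eigenspace of `ad 𝔞` with eigenvalue form `l`. -/
def restrictedRootSpace (𝔞 : Submodule ℝ 𝔤) (l : Dual ℝ 𝔞) : Set 𝔤 :=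
  {x | ∀ h : 𝔞, ⁅(h : 𝔤), x⁆ = l h • x}

/-- The restricted roots of `𝔤` with respect to `𝔞`. -/
def restrictedRoots (𝔞 : Submodule ℝ 𝔤) : Set (Dual ℝ 𝔞) :=
  {l | l ≠ 0 ∧ ∃ x ∈ restrictedRootSpace 𝔞 l, x ≠ 0}

/-- `s` is a system of simple roots of `R`. -/
def IsSimpleSystem {V : Type*} [AddCommGroup V] [Module ℝ V] (R : Set V) {r : ℕ}
    (s : Fin r → V) : Prop :=
  LinearIndependent ℝ s ∧ (∀ i, s i ∈ R) ∧
    ∀ l ∈ R, l ∈ AddSubmonoid.closure (Set.range s) ∨ -l ∈ AddSubmonoid.closure (Set.range s)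

/-- The roots of `R` that are positive with respect to the simple system `s`. -/
def positiveRoots {V : Type*} [AddCommGroup V] [Module ℝ V] (R : Set V) {r : ℕ}
    (s : Fin r → V) : Set V :=
  {l | l ∈ R ∧ l ∈ AddSubmonoid.closure (Set.range s)}

/-- `θ` is the highest root of `R` with respect to the simple system `s`. -/
def IsHighestRoot {V : Type*} [AddCommGroup V] [Module ℝ V] (R : Set V) {r : ℕ}
    (s : Fin r → V) (θ : V) : Prop :=
  θ ∈ R ∧ ∀ l ∈ R, θ - l ∈ AddSubmonoid.closure (Set.range s)

/-- For a semisimple subalgebra `F` of `𝔤` and a splitting Cartan subalgebra `T` of `F` (both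
properties are expressed by type classes where this definition is used): `F` is a maximal split
subalgebra of `𝔤`, i.e. `T` is equal to `𝔞` as a subspace of `𝔤`, and the roots of `F` are the
indivisible restricted roots of `𝔤`. -/
def IsMaximalSplitSubalgebra (𝔞 : Submodule ℝ 𝔤) (F : LieSubalgebra ℝ 𝔤)
    (T : LieSubalgebra ℝ F) : Prop :=
  (∀ x : 𝔤, x ∈ 𝔞 ↔ ∃ t : F, t ∈ T ∧ (t : 𝔤) = x) ∧
    ∀ l : Dual ℝ 𝔞, (l ≠ 0 ∧ ∃ x ∈ F, x ∈ restrictedRootSpace 𝔞 l ∧ x ≠ 0) ↔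
      (l ∈ restrictedRoots 𝔞 ∧ (1 / 2 : ℝ) • l ∉ restrictedRoots 𝔞)

/-! ## Scale factors, walls and billiard -/

/-- The space of the logarithmic scale factors `(β¹, β²)` (components `0` and `1`) and of the
dilatons `φ ∈ 𝔞`. -/
abbrev ScaleSpace (𝔞 : Submodule ℝ 𝔤) : Type _ := (Fin 2 → ℝ) × 𝔞

variable {𝔞 : Submodule ℝ 𝔤}

/-- The linear form `βⁱ`. -/
def betaForm (𝔞 : Submodule ℝ 𝔤) (i : Fin 2) : Dual ℝ (ScaleSpace 𝔞) :=
  LinearMap.proj i ∘ₗ LinearMap.fst ℝ (Fin 2 → ℝ) 𝔞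

/-- A linear form in the dilatons, as a form in all the scale factors. -/
def dilatonForm (l : Dual ℝ 𝔞) : Dual ℝ (ScaleSpace 𝔞) :=
  l ∘ₗ LinearMap.snd ℝ (Fin 2 → ℝ) 𝔞

/-- The partial derivative `∂ᵢ f` with respect to `βⁱ`. -/
def dBeta (f : Dual ℝ (ScaleSpace 𝔞)) (i : Fin 2) : ℝ := f (Pi.single i 1, 0)

/-- The partial derivative `∂_a f` with respect to the dilaton `φᵃ`, where the dilatons are the
coordinates in the basis `e` of `𝔞`. -/
def dPhi {r : ℕ} (e : Basis (Fin r) ℝ 𝔞) (f : Dual ℝ (ScaleSpace 𝔞)) (a : Fin r) : ℝ :=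
  f (0, e a)

/-- The metric `∑ (dβⁱ)² - (∑ dβⁱ)² + ∑ (dφᵃ)²`, polarized. -/
def scaleMetric {r : ℕ} (e : Basis (Fin r) ℝ 𝔞) (x y : ScaleSpace 𝔞) : ℝ :=
  ∑ i, x.1 i * y.1 i - (∑ i, x.1 i) * (∑ i, y.1 i) + ∑ a, e.repr x.2 a * e.repr y.2 a

/-- The inverse metric `(f|g) = ∑ ∂ᵢf ∂ᵢg - (∑ ∂ᵢf)(∑ ∂ᵢg) + ∑ ∂_a f ∂_a g` on linear forms. -/
def formProduct {r : ℕ} (e : Basis (Fin r) ℝ 𝔞) (f g : Dual ℝ (ScaleSpace 𝔞)) : ℝ :=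
  ∑ i, dBeta f i * dBeta g i - (∑ i, dBeta f i) * (∑ i, dBeta g i)
    + ∑ a, dPhi e f a * dPhi e g a

/-- The vector that the metric associates with a linear form `f`. -/
def sharp {r : ℕ} (e : Basis (Fin r) ℝ 𝔞) (f : Dual ℝ (ScaleSpace 𝔞)) : ScaleSpace 𝔞 :=
  (fun i => dBeta f i - ∑ k, dBeta f k, ∑ a, dPhi e f a • e a)

/-- `sharp` is indeed the identification of forms with vectors given by the metric. -/
theorem scaleMetric_sharp {r : ℕ} (e : Basis (Fin r) ℝ 𝔞) (f : Dual ℝ (ScaleSpace 𝔞))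
    (x : ScaleSpace 𝔞) : scaleMetric e (sharp e f) x = f x := by
  have hx : x = (∑ i, x.1 i • ((Pi.single i 1, 0) : ScaleSpace 𝔞))
      + ∑ a, e.repr x.2 a • ((0, e a) : ScaleSpace 𝔞) := by
    refine Prod.ext ?_ ?_
    · ext j
      fin_cases j <;> simp [Prod.fst_sum, Fin.sum_univ_two]
    · simp [Prod.snd_sum, e.sum_repr]
  have hr : ∀ a, e.repr (∑ b, dPhi e f b • e b) a = dPhi e f a := by
    intro a
    rw [e.repr_sum_self]
  conv_rhs => rw [hx]
  simp only [scaleMetric, sharp, hr]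
  simp only [map_add, map_sum, map_smul, smul_eq_mul, Fin.sum_univ_two, dBeta, dPhi]
  have : ∀ a, f (0, e a) * e.repr x.2 a = e.repr x.2 a * f (0, e a) := fun a => mul_comm _ _
  simp only [this]
  ring

/-- `formProduct` is the inverse of the metric. -/
theorem apply_sharp {r : ℕ} (e : Basis (Fin r) ℝ 𝔞) (f g : Dual ℝ (ScaleSpace 𝔞)) :
    g (sharp e f) = formProduct e f g := by
  rw [← scaleMetric_sharp e g]
  have hr : ∀ (k : Dual ℝ (ScaleSpace 𝔞)) (a), e.repr (∑ b, dPhi e k b • e b) a = dPhi e k a := by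
    intro k a
    rw [e.repr_sum_self]
  have : ∀ a, dPhi e g a * dPhi e f a = dPhi e f a * dPhi e g a := fun a => mul_comm _ _
  simp only [scaleMetric, sharp, formProduct, hr, Fin.sum_univ_two, this]
  ring

/-- The vector `2 f^♯ / (f|f)`; the reflection in the wall `f = 0` is `x ↦ x - f(x) · 2 f^♯/(f|f)`. -/
def wallCoroot {r : ℕ} (e : Basis (Fin r) ℝ 𝔞) (f : Dual ℝ (ScaleSpace 𝔞)) : ScaleSpace 𝔞 :=
  (2 / formProduct e f f) • sharp e f

/-- The axion electric wall form `λ(φ)`. -/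
def electricWall (l : Dual ℝ 𝔞) : Dual ℝ (ScaleSpace 𝔞) := dilatonForm l

/-- The axion magnetic wall form `βⁱ - λ(φ)`. -/
def magneticWall (i : Fin 2) (l : Dual ℝ 𝔞) : Dual ℝ (ScaleSpace 𝔞) :=
  betaForm 𝔞 i - dilatonForm l

/-- The symmetry wall form `β² - β¹`. -/
def symmetryWall (𝔞 : Submodule ℝ 𝔤) : Dual ℝ (ScaleSpace 𝔞) := betaForm 𝔞 1 - betaForm 𝔞 0

/-- The billiard: all wall forms are nonnegative. The axions correspond to the positive restricted
roots (each repeated according to its multiplicity, which does not matter here). -/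
def billiard {r : ℕ} (s : Fin r → Dual ℝ 𝔞) : Set (ScaleSpace 𝔞) :=
  {x | (∀ l ∈ positiveRoots (restrictedRoots 𝔞) s, 0 ≤ electricWall l x) ∧
    (∀ i, ∀ l ∈ positiveRoots (restrictedRoots 𝔞) s, 0 ≤ magneticWall i l x) ∧
    0 ≤ symmetryWall 𝔞 x}

/-- The `r + 2` dominant wall forms: `σ_i`, then `β¹ - θ`, then `β² - β¹`. -/
def dominantWall {r : ℕ} (s : Fin r → Dual ℝ 𝔞) (θ : Dual ℝ 𝔞) :
    Option (Option (Fin r)) → Dual ℝ (ScaleSpace 𝔞)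
  | some (some i) => electricWall (s i)
  | some none => magneticWall 0 θ
  | none => symmetryWall 𝔞

/-- The chamber `C` in the space of scale factors, with wall forms `w`, is the fundamental Weyl
chamber of the Kac–Moody algebra with Cartan matrix `A`. That is: up to a numbering `ν` of the
nodes, `A` is the matrix `2 (wᵢ|wⱼ) / (wᵢ|wᵢ)`, and there is a linear isomorphism of the space of
scale factors onto the Cartan subalgebra that carries the vectors `2 wᵢ^♯ / (wᵢ|wᵢ)` to the simple
coroots, the wall forms to the simple roots (hence the reflections in the walls to the fundamental
Weyl reflections), and `C` onto the fundamental Weyl chamber. -/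
def IsWeylChamberOf {r : ℕ} (e : Basis (Fin r) ℝ 𝔞) (C : Set (ScaleSpace 𝔞)) {ι J : Type*}
    [DecidableEq J] (w : ι → Dual ℝ (ScaleSpace 𝔞)) (A : Matrix J J ℤ) : Prop :=
  ∃ ν : ι ≃ J,
    (∀ i j, (A (ν i) (ν j) : ℝ) = 2 * formProduct e (w i) (w j) / formProduct e (w i) (w i)) ∧
    ∃ Ψ : ScaleSpace 𝔞 ≃ₗ[ℝ] KacMoody.cartan A,
      (∀ i, (Ψ (wallCoroot e (w i)) : KacMoody.Algebra A) = KacMoody.genH A (ν i)) ∧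
      (∀ i, KacMoody.genE A (ν i) ≠ 0 ∧ ∀ x,
        ⁅(Ψ x : KacMoody.Algebra A), KacMoody.genE A (ν i)⁆ = w i x • KacMoody.genE A (ν i)) ∧
      Ψ '' C = KacMoody.fundamentalWeylChamber A

open Classical in
/-- The chamber `C` with wall forms `w` is the fundamental Weyl chamber of the overextension
`F^∧∧`, where `F` is a split semisimple Lie algebra with root system `P`: the Cartan matrix of `F^∧`
is that of the untwisted affine extension, formed with simple roots `b` and highest root `η`, and
`F^∧∧` is its Lorentzian extension at the affine root. (Different choices of `b` only relabel the
matrix.) -/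
def IsWeylChamberOfOverextension {r : ℕ} (e : Basis (Fin r) ℝ 𝔞) (C : Set (ScaleSpace 𝔞))
    {ι : Type*} (w : ι → Dual ℝ (ScaleSpace 𝔞)) {κ M N : Type*} [AddCommGroup M] [Module ℝ M]
    [AddCommGroup N] [Module ℝ N] (P : RootPairing κ ℝ M N) [P.IsCrystallographic] : Prop :=
  ∃ (b : P.Base) (η : κ), b.IsHighestRoot η ∧
    IsWeylChamberOf e C w (KacMoody.lorentzianExtension (b.untwistedAffine η) none)

end Restricted

end

/-! Every positive root `λ`, and every `θ - λ`, is a sum of simple roots. Hence each wall form is a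
nonnegative combination of the `r + 2` dominant ones: `β¹ - λ = (β¹ - θ) + (θ - λ)`, and `β² - λ`
has the extra term `β² - β¹`. This cuts out the chamber.

In the inverse metric `β¹` is null, orthogonal to the dilatons, and has product `-1` with `β² - β¹`,
whose norm is `2`. So `β¹ - θ` has the scalar products with the `σᵢ` and with itself that `-θ` has:
it plays the affine root. The form `β² - β¹` is the extra node, attached to it by a single line.
What remains is to recognise the Cartan matrix of the `σᵢ` and `-θ`, and to pass from a Gram matrix
to a Kac–Moody algebra.

For the passage, `isWeylChamberOf_of_formProduct` needs that no generator `Eⱼ` collapses under the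
Chevalley–Serre relations. This is `genE_ne_zero`, shown by letting the algebra act on a Verma-type
module modulo its Serre vectors.

For the matrix, a restricted root vector `x` and `τ x` span, with their bracket, an `𝔰𝔩₂`; its
representation theory makes the restricted roots a crystallographic root system
(`isRootSet_restrictedRoots`). The two cases are separated by whether `θ/2` is a root. If it is not,
the `σᵢ` and `θ` are all roots of `F`, and `pairing_eq` expresses the Cartan integers of `F` through
the dilaton metric, which yields the untwisted affine matrix. If it is, `exists_bc_basis` produces
an orthogonal frame `uᵢ` of short roots in which the system is visibly `bc`. Its simple roots are
`u₀` and `uᵢ - uᵢ₋₁`, and `θ` is twice the last `uᵢ`: this is the diagram of `A_{2r}^{(2)}`. -/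

noncomputable section

namespace KacMoody

/-! ### The Chevalley relations -/

/-- The relations between Chevalley generators other than the Serre relations. -/
structure ChevalleyRelations {J L : Type*} [DecidableEq J] [LieRing L] [LieAlgebra ℝ L]
    (A : Matrix J J ℤ) (H E F : J → L) : Prop where
  lie_H_H : ∀ i j, ⁅H i, H j⁆ = 0
  lie_E_F : ∀ i j, ⁅E i, F j⁆ = if i = j then H i else 0
  lie_H_E : ∀ i j, ⁅H i, E j⁆ = (A i j : ℝ) • E j
  lie_H_F : ∀ i j, ⁅H i, F j⁆ = -((A i j : ℝ) • F j)

/-- The left-hand side of a Serre relation. -/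
def serre {J L : Type*} [LieRing L] [LieAlgebra ℝ L] (A : Matrix J J ℤ) (X : J → L) (i j : J) : L :=
  ((LieAlgebra.ad ℝ L (X i)) ^ (-A i j).toNat) ⁅X i, X j⁆

theorem lie_ad_pow {L : Type*} [LieRing L] [LieAlgebra ℝ L] {x z : L} (h : ⁅x, z⁆ = 0) (y : L)
    (n : ℕ) : ⁅x, ((LieAlgebra.ad ℝ L z) ^ n) y⁆ = ((LieAlgebra.ad ℝ L z) ^ n) ⁅x, y⁆ := by
  induction n with
  | zero => simp
  | succ n ih =>
    rw [pow_succ', Module.End.mul_apply, Module.End.mul_apply, LieAlgebra.ad_apply,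
      LieAlgebra.ad_apply, leibniz_lie, h, ih]
    simp

/-- A generalized Cartan matrix. -/
structure IsGCM {J : Type*} (A : Matrix J J ℤ) : Prop where
  diag : ∀ i, A i i = 2
  nonpos : ∀ i j, i ≠ j → A i j ≤ 0
  symm_zero : ∀ i j, A i j = 0 → A j i = 0

/-! ### Serre elements commute with the opposite generators. -/

section Serre

variable {J L : Type*} [DecidableEq J] [LieRing L] [LieAlgebra ℝ L] {A : Matrix J J ℤ}
  {H E F : J → L}

theorem ChevalleyRelations.symm (h : ChevalleyRelations A H E F) :
    ChevalleyRelations A (fun i => -H i) F E where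
  lie_H_H i j := by simp [h.lie_H_H]
  lie_E_F i j := by
    rw [← lie_skew, h.lie_E_F]
    by_cases hij : i = j
    · subst hij; simp
    · simp [hij, Ne.symm hij]
  lie_H_E i j := by simp [h.lie_H_F]
  lie_H_F i j := by simp [h.lie_H_E]

theorem ChevalleyRelations.isSl2Triple (h : ChevalleyRelations A H E F) (hA : IsGCM A) {i : J}
    (hi : H i ≠ 0) : IsSl2Triple (H i) (E i) (F i) where
  h_ne_zero := hi
  lie_e_f := by simp [h.lie_E_F]
  lie_h_e_nsmul := by rw [h.lie_H_E, hA.diag]; norm_num [two_smul]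
  lie_h_f_nsmul := by rw [h.lie_H_F, hA.diag]; norm_num [two_smul]

/-- The elements `(ad Fᵢ)^{1 - aᵢⱼ} Fⱼ` commute with the raising generators. -/
theorem ChevalleyRelations.lie_E_serre (h : ChevalleyRelations A H E F) (hA : IsGCM A)
    (hH : ∀ i, H i ≠ 0) (k i j : J) : ⁅E k, serre A F i j⁆ = 0 := by
  unfold serre
  rcases eq_or_ne i j with rfl | hij
  · simp
  by_cases hki : k = i
  · subst hki
    by_cases hF : F j = 0
    · simp [hF]
    -- For the `𝔰𝔩₂` of node `k`, `F j` is primitive of weight `μ = -A k j`. Applying `E` to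
    -- `f^(n+1)` of it gives the factor `(n + 1)(μ - n)`, which vanishes at `n = -A k j`, exactly
    -- the Serre exponent.
    have P : (h.isSl2Triple hA (hH k)).HasPrimitiveVectorWith (F j) (-(A k j : ℝ)) :=
      { ne_zero := hF
        lie_h := by rw [h.lie_H_F, neg_smul]
        lie_e := by simp [h.lie_E_F, hij] }
    have := P.lie_e_pow_succ_toEnd_f (-A k j).toNat
    rw [pow_succ, Module.End.mul_apply] at this
    refine Eq.trans this ?_
    have h0 : (((-A k j).toNat : ℕ) : ℝ) = -(A k j : ℝ) := by
      have : (((-A k j).toNat : ℕ) : ℤ) = -A k j :=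
        Int.toNat_of_nonneg (by have := hA.nonpos k j hij; omega)
      exact_mod_cast this
    rw [h0]
    simp
  -- Here `E k` commutes with `F i`, so it passes to the innermost bracket and meets only `F j`. For
  -- `k = j` this leaves a multiple `A k i` of `F i`, killed by a further `ad (F i)`. If none is
  -- left then `A i k = 0`, so the multiple vanishes by the symmetry of zeros.
  · rw [lie_ad_pow (by simp [h.lie_E_F, hki]), leibniz_lie, h.lie_E_F, h.lie_E_F, if_neg hki]
    by_cases hkj : k = j
    · subst hkj
      rw [if_pos rfl, zero_lie, zero_add, ← lie_skew, h.lie_H_F, neg_neg]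
      rcases Nat.eq_zero_or_pos (-A i k).toNat with h0 | h0
      · have : A i k = 0 := by have := hA.nonpos i k hij; omega
        simp [hA.symm_zero _ _ this]
      · obtain ⟨n, hn⟩ := Nat.exists_eq_succ_of_ne_zero h0.ne'
        rw [hn, pow_succ, Module.End.mul_apply]
        simp
    · simp [hkj]

end Serre

theorem serre_map {J L L' : Type*} [LieRing L] [LieAlgebra ℝ L] [LieRing L'] [LieAlgebra ℝ L']
    (ρ : L →ₗ⁅ℝ⁆ L') (A : Matrix J J ℤ) (X : J → L) (i j : J) :
    ρ (serre A X i j) = serre A (fun k => ρ (X k)) i j := by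
  unfold serre
  induction (-A i j).toNat with
  | zero => simp
  | succ n ih =>
    rw [pow_succ', pow_succ', Module.End.mul_apply, Module.End.mul_apply, LieAlgebra.ad_apply,
      LieAlgebra.ad_apply, LieHom.map_lie, ih]

/-- A representation of the Chevalley and Serre relations yields one of the Kac–Moody algebra. -/
theorem genE_ne_zero_of_rep {J L : Type*} [DecidableEq J] [LieRing L] [LieAlgebra ℝ L]
    {A : Matrix J J ℤ} {H E F : J → L} (rel : ChevalleyRelations A H E F)
    (sE : ∀ i j, serre A E i j = 0) (sF : ∀ i j, serre A F i j = 0) {j : J} (hH : H j ≠ 0) :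
    genE A j ≠ 0 := by
  let ρ : FreeLieAlgebra ℝ (CartanMatrix.Generators J) →ₗ⁅ℝ⁆ L :=
    FreeLieAlgebra.lift ℝ fun g => match g with
      | CartanMatrix.Generators.H i => H i
      | CartanMatrix.Generators.E i => E i
      | CartanMatrix.Generators.F i => F i
  have ρH : ∀ i, ρ (FreeLieAlgebra.of ℝ (CartanMatrix.Generators.H i)) = H i := fun i => by
    simp [ρ]
  have ρE : ∀ i, ρ (FreeLieAlgebra.of ℝ (CartanMatrix.Generators.E i)) = E i := fun i => by
    simp [ρ]
  have ρF : ∀ i, ρ (FreeLieAlgebra.of ℝ (CartanMatrix.Generators.F i)) = F i := fun i => by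
    simp [ρ]
  have hker : CartanMatrix.Relations.toIdeal ℝ A ≤ ρ.ker := by
    refine LieSubmodule.lieSpan_le.2 ?_
    rintro x (((((⟨⟨i, j⟩, rfl⟩ | ⟨⟨i, j⟩, rfl⟩) | ⟨⟨i, j⟩, rfl⟩) | ⟨⟨i, j⟩, rfl⟩) | ⟨⟨i, j⟩, rfl⟩) |
      ⟨⟨i, j⟩, rfl⟩)
    · simp [CartanMatrix.Relations.HH, ρH, rel.lie_H_H]
    · by_cases hij : i = j
      · subst hij
        simp [CartanMatrix.Relations.EF, ρE, ρF, ρH, rel.lie_E_F]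
      · simp [CartanMatrix.Relations.EF, ρE, ρF, rel.lie_E_F, hij]
    · simp [CartanMatrix.Relations.HE, ρE, ρH, rel.lie_H_E, ← Int.cast_smul_eq_zsmul ℝ]
    · simp [CartanMatrix.Relations.HF, ρF, ρH, rel.lie_H_F, ← Int.cast_smul_eq_zsmul ℝ]
    · have := serre_map ρ A (fun i => FreeLieAlgebra.of ℝ (CartanMatrix.Generators.E i)) i j
      simp only [ρE, sE] at this
      exact this
    · have := serre_map ρ A (fun i => FreeLieAlgebra.of ℝ (CartanMatrix.Generators.F i)) i j
      simp only [ρF, sF] at this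
      exact this
  intro h0
  have hmem : FreeLieAlgebra.of ℝ (CartanMatrix.Generators.E j) ∈ ρ.ker :=
    hker ((LieSubmodule.Quotient.mk_eq_zero' (N := CartanMatrix.Relations.toIdeal ℝ A)).1 h0)
  rw [LieHom.mem_ker, ρE] at hmem
  -- Were `E j` zero, `H j = ⁅E j, F j⁆` would vanish too.
  have := rel.lie_E_F j j
  rw [if_pos rfl, hmem, zero_lie] at this
  exact hH this.symm

/-! ### Serre elements as iterated commutators of operators. -/

section Associative

attribute [local instance] LieRing.ofAssociativeRing

variable {J B B' : Type*} [Ring B] [_root_.Algebra ℝ B] [Ring B']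
  [_root_.Algebra ℝ B']

theorem serre_induction (A : Matrix J J ℤ) (X : J → B) (i j : J) {p : B → Prop}
    (h0 : p (X i * X j - X j * X i)) (hs : ∀ Y, p Y → p (X i * Y - Y * X i)) :
    p (serre A X i j) := by
  unfold serre
  induction (-A i j).toNat with
  | zero => exact h0
  | succ n ih =>
    rw [pow_succ', Module.End.mul_apply, LieAlgebra.ad_apply]
    exact hs _ ih

/-- Serves to compare Serre elements of operators on a module with those of the induced operators on
a quotient. -/
theorem serre_induction₂ (A : Matrix J J ℤ) (X : J → B) (X' : J → B') (i j : J)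
    {p : B → B' → Prop} (h0 : p (X i * X j - X j * X i) (X' i * X' j - X' j * X' i))
    (hs : ∀ Y Y', p Y Y' → p (X i * Y - Y * X i) (X' i * Y' - Y' * X' i)) :
    p (serre A X i j) (serre A X' i j) := by
  unfold serre
  induction (-A i j).toNat with
  | zero => exact h0
  | succ n ih =>
    rw [pow_succ', pow_succ', Module.End.mul_apply, Module.End.mul_apply, LieAlgebra.ad_apply,
      LieAlgebra.ad_apply]
    exact hs _ _ ih

theorem ChevalleyRelations.of_commutators [DecidableEq J] {A : Matrix J J ℤ} {H E F : J → B}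
    (hHH : ∀ i j, H i * H j = H j * H i)
    (hEF : ∀ i j, E i * F j = F j * E i + if i = j then H i else 0)
    (hHE : ∀ i j, H i * E j = E j * H i + (A i j : ℝ) • E j)
    (hHF : ∀ i j, H i * F j = F j * H i - (A i j : ℝ) • F j) :
    ChevalleyRelations A H E F where
  lie_H_H i j := by rw [LieRing.of_associative_ring_bracket, hHH, sub_self]
  lie_E_F i j := by rw [LieRing.of_associative_ring_bracket, hEF, add_sub_cancel_left]
  lie_H_E i j := by rw [LieRing.of_associative_ring_bracket, hHE, add_sub_cancel_left]
  lie_H_F i j := by rw [LieRing.of_associative_ring_bracket, hHF]; abel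

theorem ChevalleyRelations.commute_E_serre [DecidableEq J] {A : Matrix J J ℤ} {H E F : J → B}
    (h : ChevalleyRelations A H E F) (hA : IsGCM A) (hH : ∀ i, H i ≠ 0) (k i j : J) :
    E k * serre A F i j = serre A F i j * E k := by
  have := h.lie_E_serre hA hH k i j
  rwa [LieRing.of_associative_ring_bracket, sub_eq_zero] at this

/-- If the `Xᵢ` are eigenvectors of `ad K`, so are the Serre elements. -/
theorem exists_mul_serre_eq (A : Matrix J J ℤ) (X : J → B) (K : B)
    (hX : ∀ i, ∃ c : ℝ, K * X i = X i * K + c • X i) (i j : J) :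
    ∃ c : ℝ, K * serre A X i j = serre A X i j * K + c • serre A X i j := by
  have hmul : ∀ X Y : B, (∃ c : ℝ, K * X = X * K + c • X) → (∃ c : ℝ, K * Y = Y * K + c • Y) →
      ∃ c : ℝ, K * (X * Y - Y * X) = (X * Y - Y * X) * K + c • (X * Y - Y * X) := by
    rintro X Y ⟨c, hc⟩ ⟨d, hd⟩
    refine ⟨c + d, ?_⟩
    have h1 : K * (X * Y) = X * Y * K + (c + d) • (X * Y) := by
      rw [← mul_assoc, hc, add_mul, mul_assoc, hd, mul_add, smul_mul_assoc, mul_smul_comm,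
        ← mul_assoc]
      module
    have h2 : K * (Y * X) = Y * X * K + (c + d) • (Y * X) := by
      rw [← mul_assoc, hd, add_mul, mul_assoc, hc, mul_add, smul_mul_assoc, mul_smul_comm,
        ← mul_assoc]
      module
    rw [mul_sub, h1, h2, sub_mul]
    module
  exact serre_induction A X i j (p := fun Z => ∃ c : ℝ, K * Z = Z * K + c • Z)
    (hmul _ _ (hX i) (hX j)) fun Y hY => hmul _ _ (hX i) hY

end Associative

/-! ### The Verma-type module on words -/

section Words

attribute [local instance] LieRing.ofAssociativeRing

variable {J : Type*}

/-- The free module on words in the lowering generators. -/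
abbrev Words (J : Type*) := List J →₀ ℝ

/-- A lowering generator adds a letter. -/
def lowering (i : J) : Module.End ℝ (Words J) := Finsupp.lmapDomain ℝ ℝ (List.cons i)

/-- The eigenvalue of the `k`-th coroot on a word. -/
def wordWeight (A : Matrix J J ℤ) (k : J) : List J → ℝ
  -- The highest weight takes the value 1 on every coroot. Any nonzero value would do: it ensures
  -- that no coroot acts as zero.
  | [] => 1
  | i :: w => wordWeight A k w - A k i

/-- The action of the coroots. -/
def coroot (A : Matrix J J ℤ) (k : J) : Module.End ℝ (Words J) :=
  Finsupp.linearCombination ℝ (fun w => Finsupp.single w (wordWeight A k w))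

/-- The action of a raising generator on a word. -/
def raisingWord [DecidableEq J] (A : Matrix J J ℤ) (k : J) : List J → Words J
  | [] => 0
  -- Forced by `E_k F_i = F_i E_k + δ_{ki} H_k` together with `E_k` killing the empty word.
  | i :: w => (if k = i then Finsupp.single w (wordWeight A k w) else 0)
      + lowering i (raisingWord A k w)

/-- The action of the raising generators. -/
def raising [DecidableEq J] (A : Matrix J J ℤ) (k : J) : Module.End ℝ (Words J) :=
  Finsupp.linearCombination ℝ (raisingWord A k)

theorem lowering_single (i : J) (w : List J) (c : ℝ) :
    lowering i (Finsupp.single w c) = Finsupp.single (i :: w) c := by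
  simp [lowering, Finsupp.mapDomain_single]

theorem coroot_single (A : Matrix J J ℤ) (k : J) (w : List J) :
    coroot A k (Finsupp.single w 1) = wordWeight A k w • Finsupp.single w 1 := by
  simp [coroot]

theorem raising_single [DecidableEq J] (A : Matrix J J ℤ) (k : J) (w : List J) :
    raising A k (Finsupp.single w 1) = raisingWord A k w := by
  simp [raising]

theorem raising_single_nil [DecidableEq J] (A : Matrix J J ℤ) (k : J) :
    raising A k (Finsupp.single [] 1) = 0 := by
  simp [raising, raisingWord]

theorem words_ext {f g : Module.End ℝ (Words J)}
    (h : ∀ w, f (Finsupp.single w 1) = g (Finsupp.single w 1)) : f = g :=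
  Finsupp.lhom_ext' fun w => LinearMap.ext_ring (by simpa using h w)

theorem coroot_mul_lowering (A : Matrix J J ℤ) (i j : J) :
    coroot A i * lowering j = lowering j * coroot A i - (A i j : ℝ) • lowering j := by
  refine words_ext fun w => ?_
  simp only [LinearMap.sub_apply, Module.End.mul_apply, lowering_single,
    coroot_single, LinearMap.smul_apply, map_smul, wordWeight]
  module

theorem raising_mul_lowering [DecidableEq J] (A : Matrix J J ℤ) (i j : J) :
    raising A i * lowering j = lowering j * raising A i + if i = j then coroot A i else 0 := by
  refine words_ext fun w => ?_
  simp only [LinearMap.add_apply, Module.End.mul_apply, lowering_single,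
    raising_single, raisingWord]
  rw [add_comm]
  split_ifs <;> simp [coroot_single]

theorem coroot_raisingWord [DecidableEq J] (A : Matrix J J ℤ) (i j : J) (w : List J) :
    coroot A i (raisingWord A j w) = (wordWeight A i w + A i j) • raisingWord A j w := by
  induction w with
  | nil => simp [raisingWord]
  | cons k w ih =>
    have h := LinearMap.congr_fun (coroot_mul_lowering A i k) (raisingWord A j w)
    simp only [LinearMap.sub_apply, Module.End.mul_apply,
      LinearMap.smul_apply, ih, map_smul] at h
    simp only [raisingWord, map_add, h, wordWeight]
    split_ifs with hjk
    · subst hjk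
      rw [← Finsupp.smul_single_one, map_smul, coroot_single]
      module
    · simp only [map_zero]
      module

theorem chevalleyRelations_words [DecidableEq J] (A : Matrix J J ℤ) :
    ChevalleyRelations A (coroot A) (raising A) (lowering (J := J)) := by
  refine .of_commutators (fun i j => ?_) (raising_mul_lowering A) (fun i j => ?_)
    (coroot_mul_lowering A)
  · refine words_ext fun w => ?_
    simp only [Module.End.mul_apply, coroot_single, map_smul, smul_smul, mul_comm]
  · refine words_ext fun w => ?_
    simp only [LinearMap.add_apply, Module.End.mul_apply, raising_single,
      coroot_single, LinearMap.smul_apply, map_smul, coroot_raisingWord]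
    module

theorem coroot_ne_zero (A : Matrix J J ℤ) (i : J) : coroot A i ≠ 0 := by
  intro h
  have := LinearMap.congr_fun h (Finsupp.single [] 1)
  rw [coroot_single] at this
  simp [wordWeight] at this

/-- No quotient is needed on the raising side. The element kills the empty word because every
raising generator does, and it commutes with all lowering generators (`commute_E_serre` with the
roles of `E` and `F` exchanged), so it kills every word. -/
theorem serre_raising [DecidableEq J] (A : Matrix J J ℤ) (hA : IsGCM A) (i j : J) :
    serre A (raising A) i j = 0 := by
  have hnil : serre A (raising A) i j (Finsupp.single [] 1) = 0 := by
    refine serre_induction A (raising A) i j (p := fun X => X (Finsupp.single [] 1) = 0) ?_ ?_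
    · simp [raising_single_nil]
    · intro Y hY
      simp [hY, raising_single_nil]
  refine words_ext fun w => ?_
  induction w with
  | nil => simpa using hnil
  | cons k w ih =>
    have := LinearMap.congr_fun ((chevalleyRelations_words A).symm.commute_E_serre hA
      (fun i => neg_ne_zero.2 (coroot_ne_zero A i)) k i j) (Finsupp.single w 1)
    simp only [Module.End.mul_apply, lowering_single, ih, LinearMap.zero_apply, map_zero] at this
    simpa using this.symm

/-- The submodule generated by the Serre elements in the lowering generators. -/
def serreSubmodule (A : Matrix J J ℤ) : Submodule ℝ (Words J) :=
  Submodule.span ℝ {m | ∃ (p : List J) (i j : J) (w : List J),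
    m = (p.map lowering).prod (serre A lowering i j (Finsupp.single w 1))}

theorem mem_serreSubmodule (A : Matrix J J ℤ) (p : List J) (i j : J) (w : List J) :
    (p.map lowering).prod (serre A lowering i j (Finsupp.single w 1)) ∈ serreSubmodule A :=
  Submodule.subset_span ⟨p, i, j, w, rfl⟩

theorem serre_apply_mem (A : Matrix J J ℤ) (i j : J) (m : Words J) :
    serre A lowering i j m ∈ serreSubmodule A := by
  induction m using Finsupp.induction_linear with
  | zero => simp
  | add f g hf hg => rw [map_add]; exact add_mem hf hg
  | single w c =>
    rw [← Finsupp.smul_single_one, map_smul]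
    exact Submodule.smul_mem _ _ (by simpa using mem_serreSubmodule A [] i j w)

theorem lowering_mem (A : Matrix J J ℤ) (k : J) :
    serreSubmodule A ≤ (serreSubmodule A).comap (lowering k) := by
  refine Submodule.span_le.2 ?_
  rintro _ ⟨p, i, j, w, rfl⟩
  exact mem_serreSubmodule A (k :: p) i j w

/-- Each spanning vector is an eigenvector, since letters and Serre elements shift the weight by
scalars. -/
theorem coroot_mem (A : Matrix J J ℤ) (k : J) :
    serreSubmodule A ≤ (serreSubmodule A).comap (coroot A k) := by
  have hF : ∀ i : J, ∃ c : ℝ, coroot A k * lowering i = lowering i * coroot A k + c • lowering i :=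
    fun i => ⟨-(A k i : ℝ), by rw [coroot_mul_lowering]; module⟩
  have happ : ∀ (X : Module.End ℝ (Words J)) (m : Words J),
      (∃ c : ℝ, coroot A k * X = X * coroot A k + c • X) →
      (∃ c : ℝ, coroot A k m = c • m) → ∃ c : ℝ, coroot A k (X m) = c • X m := by
    rintro X m ⟨c, hc⟩ ⟨d, hd⟩
    have := LinearMap.congr_fun hc m
    simp only [LinearMap.add_apply, Module.End.mul_apply, hd, map_smul,
      LinearMap.smul_apply] at this
    exact ⟨d + c, by rw [add_smul, ← this]⟩
  refine Submodule.span_le.2 ?_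
  rintro _ ⟨p, i, j, w, rfl⟩
  have key : ∃ c : ℝ, coroot A k ((p.map lowering).prod (serre A lowering i j
      (Finsupp.single w 1))) = c • (p.map lowering).prod (serre A lowering i j
      (Finsupp.single w 1)) := by
    induction p with
    | nil => simpa using happ _ _ (exists_mul_serre_eq A lowering (coroot A k) hF i j) ⟨_, coroot_single A k w⟩
    | cons l p ih =>
      rw [List.map_cons, List.prod_cons, Module.End.mul_apply]
      exact happ _ _ (hF l) ih
  obtain ⟨c, hc⟩ := key
  change coroot A k _ ∈ serreSubmodule A
  rw [hc]
  exact Submodule.smul_mem _ _ (mem_serreSubmodule A p i j w)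

/-- Moving `E_k` past the letters of `p` costs only coroots, under which the submodule is stable;
having reached the Serre element, it commutes with it. -/
theorem raising_mem [DecidableEq J] (A : Matrix J J ℤ) (hA : IsGCM A) (k : J) :
    serreSubmodule A ≤ (serreSubmodule A).comap (raising A k) := by
  refine Submodule.span_le.2 ?_
  rintro _ ⟨p, i, j, w, rfl⟩
  change raising A k _ ∈ serreSubmodule A
  induction p with
  | nil =>
    have := LinearMap.congr_fun ((chevalleyRelations_words A).commute_E_serre hA
      (coroot_ne_zero A) k i j) (Finsupp.single w 1)
    simp only [Module.End.mul_apply] at this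
    simp only [List.map_nil, List.prod_nil, Module.End.one_apply, this]
    exact serre_apply_mem A i j _
  | cons l p ih =>
    rw [List.map_cons, List.prod_cons, Module.End.mul_apply]
    have := LinearMap.congr_fun (raising_mul_lowering A k l)
      ((p.map lowering).prod (serre A lowering i j (Finsupp.single w 1)))
    simp only [LinearMap.add_apply, Module.End.mul_apply] at this
    rw [this]
    refine add_mem (lowering_mem A l ih) ?_
    split_ifs
    · exact coroot_mem A k (mem_serreSubmodule A p i j w)
    · simp

/-- Lowering generators produce only nonempty words, so every spanning vector has coefficient zero
at the empty word. -/
theorem single_nil_notMem (A : Matrix J J ℤ) : Finsupp.single [] 1 ∉ serreSubmodule A := by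
  have hF : ∀ (i : J) (m : Words J), lowering i m [] = 0 := by
    intro i m
    exact Finsupp.mapDomain_of_notMem_range _ _ (by simp)
  have hs : ∀ i j (m : Words J), serre A lowering i j m [] = 0 := by
    intro i j
    refine serre_induction A lowering i j (p := fun X => ∀ m : Words J, X m [] = 0) ?_ ?_
    · intro m
      simp [hF]
    · intro Y hY m
      simp [hF, hY]
  have hle : serreSubmodule A ≤ LinearMap.ker (Finsupp.lapply (R := ℝ) ([] : List J)) := by
    refine Submodule.span_le.2 ?_
    rintro _ ⟨p, i, j, w, rfl⟩
    cases p with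
    | nil => simp [hs]
    | cons l p => simp [hF]
  intro h
  simpa using hle h

/-! ### The raising generators are nonzero -/

/-- On the words modulo `serreSubmodule A` all Chevalley and Serre relations hold, while every
coroot fixes the nonzero class of the empty word. Thus `H j` acts nontrivially, and `E j` with it.
-/
theorem genE_ne_zero [DecidableEq J] {A : Matrix J J ℤ} (hA : IsGCM A) (j : J) :
    genE A j ≠ 0 := by
  have hE := raising_mem A hA
  have hF := lowering_mem A
  have hH := coroot_mem A
  generalize hN : serreSubmodule A = N at hE hF hH
  let E' : J → Module.End ℝ (Words J ⧸ N) := fun k => N.mapQ N (raising A k) (hE k)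
  let F' : J → Module.End ℝ (Words J ⧸ N) := fun k => N.mapQ N (lowering k) (hF k)
  let H' : J → Module.End ℝ (Words J ⧸ N) := fun k => N.mapQ N (coroot A k) (hH k)
  have hext : ∀ X Y : Module.End ℝ (Words J ⧸ N), (∀ m, X (N.mkQ m) = Y (N.mkQ m)) → X = Y :=
    fun X Y h => LinearMap.ext fun x => by
      obtain ⟨m, rfl⟩ := N.mkQ_surjective x
      exact h m
  have rE : ∀ k m, E' k (N.mkQ m) = N.mkQ (raising A k m) := fun k m => rfl
  have rF : ∀ k m, F' k (N.mkQ m) = N.mkQ (lowering k m) := fun k m => rfl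
  have rH : ∀ k m, H' k (N.mkQ m) = N.mkQ (coroot A k m) := fun k m => rfl
  clear_value E' F' H'
  have hrel := chevalleyRelations_words A
  have rel : ChevalleyRelations A H' E' F' := by
    refine .of_commutators (fun i j => hext _ _ fun m => ?_) (fun i j => hext _ _ fun m => ?_)
      (fun i j => hext _ _ fun m => ?_) (fun i j => hext _ _ fun m => ?_)
    · have := LinearMap.congr_fun (sub_eq_zero.1 (hrel.lie_H_H i j)) m
      simp only [Module.End.mul_apply] at this
      simp only [Module.End.mul_apply, rH, this]
    · have := LinearMap.congr_fun (raising_mul_lowering A i j) m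
      simp only [Module.End.mul_apply, LinearMap.add_apply] at this
      simp only [Module.End.mul_apply, LinearMap.add_apply, rE, rF, this, map_add]
      split_ifs
      · rw [rH]
      · simp
    · have := LinearMap.congr_fun (sub_eq_iff_eq_add'.1 (hrel.lie_H_E i j)) m
      simp only [Module.End.mul_apply, LinearMap.add_apply, LinearMap.smul_apply] at this
      simp only [Module.End.mul_apply, LinearMap.add_apply, LinearMap.smul_apply, rE, rH, this,
        map_add, map_smul]
    · have := LinearMap.congr_fun (coroot_mul_lowering A i j) m
      simp only [Module.End.mul_apply, LinearMap.sub_apply, LinearMap.smul_apply] at this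
      simp only [Module.End.mul_apply, LinearMap.sub_apply, LinearMap.smul_apply, rF, rH, this,
        map_sub, map_smul]
  have hserre : ∀ (X : J → Module.End ℝ (Words J)) (X' : J → Module.End ℝ (Words J ⧸ N)),
      (∀ k m, X' k (N.mkQ m) = N.mkQ (X k m)) →
      ∀ i j m, serre A X' i j (N.mkQ m) = N.mkQ (serre A X i j m) := by
    intro X X' hX i j
    refine serre_induction₂ A X X' i j
      (p := fun Y Y' => ∀ m, Y' (N.mkQ m) = N.mkQ (Y m)) ?_ ?_
    · intro m
      simp only [LinearMap.sub_apply, Module.End.mul_apply, hX, map_sub]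
    · intro Y Y' hY m
      simp only [LinearMap.sub_apply, Module.End.mul_apply, hX, hY, map_sub]
  have sE : ∀ i j, serre A E' i j = 0 := fun i j => hext _ _ fun m => by
    rw [hserre _ _ rE, serre_raising A hA]; simp
  have sF : ∀ i j, serre A F' i j = 0 := fun i j => hext _ _ fun m => by
    rw [hserre _ _ rF, LinearMap.zero_apply, Submodule.mkQ_apply, Submodule.Quotient.mk_eq_zero,
      ← hN]
    exact serre_apply_mem A i j m
  have hmk : N.mkQ (Finsupp.single [] 1) ≠ 0 := by
    rw [Ne, Submodule.mkQ_apply, Submodule.Quotient.mk_eq_zero, ← hN]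
    exact single_nil_notMem A
  have hHj : H' j ≠ 0 := by
    intro h
    have := LinearMap.congr_fun h (N.mkQ (Finsupp.single [] 1))
    rw [rH, coroot_single] at this
    simp only [wordWeight, one_smul] at this
    exact hmk this
  exact genE_ne_zero_of_rep rel sE sF hHj

end Words

end KacMoody

/-! ### From the Gram matrix of the walls to the fundamental Weyl chamber. -/

namespace KacMoody

theorem lie_genH_genE {J : Type*} [DecidableEq J] (A : Matrix J J ℤ) (i j : J) :
    ⁅genH A i, genE A j⁆ = (A i j : ℝ) • genE A j := by
  have h : CartanMatrix.Relations.HE ℝ A (i, j) ∈ CartanMatrix.Relations.toIdeal ℝ A := by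
    refine LieSubmodule.subset_lieSpan ?_
    exact Or.inl (Or.inl (Or.inl (Or.inr ⟨_, rfl⟩)))
  rw [← LieSubmodule.Quotient.mk_eq_zero'] at h
  rw [Int.cast_smul_eq_zsmul, ← sub_eq_zero]
  exact h

end KacMoody

section WeylChamber

variable {𝔤 : Type*} [LieRing 𝔤] [LieAlgebra ℝ 𝔤] {𝔞 : Submodule ℝ 𝔤} {r : ℕ}

theorem formProduct_comm (e : Basis (Fin r) ℝ 𝔞) (f g : Dual ℝ (ScaleSpace 𝔞)) :
    formProduct e f g = formProduct e g f := by
  simp only [formProduct, mul_comm]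

/-- `sharp` as a linear map. -/
def sharpMap (e : Basis (Fin r) ℝ 𝔞) : Dual ℝ (ScaleSpace 𝔞) →ₗ[ℝ] ScaleSpace 𝔞 where
  toFun := sharp e
  map_add' f g := by
    refine Prod.ext ?_ ?_
    · ext i
      simp [sharp, dBeta]
      ring
    · simp [sharp, dPhi, add_smul, Finset.sum_add_distrib]
  map_smul' c f := by
    refine Prod.ext ?_ ?_
    · ext i
      simp [sharp, dBeta]
      ring
    · simp [sharp, dPhi, mul_smul, Finset.smul_sum]

theorem ker_sharpMap (e : Basis (Fin r) ℝ 𝔞) : LinearMap.ker (sharpMap e) = ⊥ := by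
  refine LinearMap.ker_eq_bot'.2 fun f hf => ?_
  have h0 : sharp e f = 0 := hf
  refine LinearMap.ext fun x => ?_
  rw [← scaleMetric_sharp e f, h0]
  simp [scaleMetric]

theorem apply_wallCoroot (e : Basis (Fin r) ℝ 𝔞) (f g : Dual ℝ (ScaleSpace 𝔞)) :
    g (wallCoroot e f) = 2 * formProduct e f g / formProduct e f f := by
  rw [wallCoroot, map_smul, apply_sharp, smul_eq_mul]
  ring

/-- A chamber with linearly independent walls at nonobtuse angles is the fundamental Weyl chamber of
the Kac–Moody algebra whose Cartan matrix is computed from the scalar products of the walls. -/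
theorem isWeylChamberOf_of_formProduct (e : Basis (Fin r) ℝ 𝔞) {ι J : Type*} [Fintype ι]
    [DecidableEq J] {w : ι → Dual ℝ (ScaleSpace 𝔞)} (hw : LinearIndependent ℝ w)
    (hcard : Fintype.card ι = r + 2) (hpos : ∀ i, 0 < formProduct e (w i) (w i))
    (hneg : ∀ i j, i ≠ j → formProduct e (w i) (w j) ≤ 0) {A : Matrix J J ℤ} (ν : ι ≃ J)
    (hA : ∀ i j, (A (ν i) (ν j) : ℝ)
      = 2 * formProduct e (w i) (w j) / formProduct e (w i) (w i)) :
    IsWeylChamberOf e {x | ∀ i, 0 ≤ w i x} w A := by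
  have hGCM : KacMoody.IsGCM A := by
    refine ⟨fun i => ?_, fun i j hij => ?_, fun i j hij => ?_⟩
    · obtain ⟨i, rfl⟩ := ν.surjective i
      have := hA i i
      rw [mul_div_assoc, div_self (hpos i).ne'] at this
      exact_mod_cast this.trans (mul_one 2)
    · obtain ⟨i, rfl⟩ := ν.surjective i
      obtain ⟨j, rfl⟩ := ν.surjective j
      have := hA i j
      have h2 : (A (ν i) (ν j) : ℝ) ≤ 0 := by
        rw [this]
        exact div_nonpos_of_nonpos_of_nonneg
          (by linarith [hneg i j (fun h => hij (congrArg ν h))]) (hpos i).le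
      exact_mod_cast h2
    · obtain ⟨i, rfl⟩ := ν.surjective i
      obtain ⟨j, rfl⟩ := ν.surjective j
      have h1 := hA i j
      have h2 := hA j i
      rw [hij, Int.cast_zero, eq_comm, div_eq_zero_iff, or_iff_left (hpos i).ne'] at h1
      rw [formProduct_comm, h1, zero_div] at h2
      exact_mod_cast h2
  have hfin : Module.Finite ℝ 𝔞 := Module.Finite.of_basis e
  have hrank : finrank ℝ (ScaleSpace 𝔞) = r + 2 := by
    rw [finrank_prod, finrank_eq_card_basis e]
    simp [add_comm]
  have hcor : LinearIndependent ℝ fun i => wallCoroot e (w i) :=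
    (hw.map' (sharpMap e) (ker_sharpMap e)).units_smul
      fun i => Units.mk0 (2 / formProduct e (w i) (w i)) (div_pos two_pos (hpos i)).ne'
  have happ : ∀ i j, w j (wallCoroot e (w i)) = A (ν i) (ν j) := fun i j => by
    rw [apply_wallCoroot, hA]
  have hspan : Submodule.span ℝ (Set.range w) = ⊤ :=
    hw.span_eq_top_of_card_eq_finrank' (by rw [hcard, Subspace.dual_finrank_eq, hrank])
  -- The `r + 2` independent wall forms span the dual of a space of dimension `r + 2`, so they
  -- separate points.
  have hsep : ∀ x, (∀ j, w j x = 0) → x = 0 := by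
    intro x hx
    refine (Module.forall_dual_apply_eq_zero_iff ℝ x).1 fun f => ?_
    have hf : f ∈ Submodule.span ℝ (Set.range w) := hspan ▸ Submodule.mem_top
    have hle : Submodule.span ℝ (Set.range w) ≤ LinearMap.ker (Dual.eval ℝ _ x) := by
      refine Submodule.span_le.2 ?_
      rintro _ ⟨j, rfl⟩
      exact hx j
    exact hle hf
  -- Apply a linear relation among the `H i` to each `E j`. Since `E j ≠ 0`, the same combination of
  -- wall coroots is annihilated by every wall form, hence is zero, and the wall coroots are
  -- independent.
  have hgen : LinearIndependent ℝ (KacMoody.genH A) := by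
    rw [← linearIndependent_equiv ν, Fintype.linearIndependent_iff]
    intro a ha
    refine Fintype.linearIndependent_iff.1 hcor a (hsep _ fun j => ?_)
    have h0 : ⁅∑ i, a i • (KacMoody.genH A ∘ ν) i, KacMoody.genE A (ν j)⁆ = 0 := by
      rw [ha, zero_lie]
    rw [sum_lie] at h0
    simp only [Function.comp_apply, smul_lie, KacMoody.lie_genH_genE, smul_smul,
      ← Finset.sum_smul] at h0
    rw [smul_eq_zero, or_iff_left (KacMoody.genE_ne_zero hGCM _)] at h0
    simpa [happ] using h0
  let bS : Basis ι ℝ (ScaleSpace 𝔞) := basisOfLinearIndependentOfCardEqFinrank' _ hcor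
    (by rw [hcard, hrank])
  have hbS : ∀ i, bS i = wallCoroot e (w i) := fun i => by
    simp [bS]
  let bH : Basis J ℝ (KacMoody.cartan A) := Basis.span hgen
  have hbH : ∀ j, (bH j : KacMoody.Algebra A) = KacMoody.genH A j := fun j =>
    congrArg Subtype.val (Basis.span_apply hgen j)
  let Ψ : ScaleSpace 𝔞 ≃ₗ[ℝ] KacMoody.cartan A := bS.equiv bH ν
  have hΨ : ∀ i, (Ψ (wallCoroot e (w i)) : KacMoody.Algebra A) = KacMoody.genH A (ν i) := by
    intro i
    rw [← hbS, Basis.equiv_apply, hbH]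
  have hlie : ∀ i x, ⁅(Ψ x : KacMoody.Algebra A), KacMoody.genE A (ν i)⁆
      = w i x • KacMoody.genE A (ν i) := by
    intro i x
    rw [← bS.sum_repr x]
    simp only [map_sum, map_smul, Submodule.coe_sum, Submodule.coe_smul, sum_lie,
      smul_lie, hbS, hΨ, KacMoody.lie_genH_genE, happ, Finset.sum_smul, smul_assoc]
  refine ⟨ν, hA, Ψ, hΨ, fun i => ⟨KacMoody.genE_ne_zero hGCM _, hlie i⟩, ?_⟩
  ext h
  constructor
  · rintro ⟨x, hx, rfl⟩ j
    obtain ⟨i, rfl⟩ := ν.surjective j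
    exact ⟨w i x, hx i, hlie i x⟩
  · intro hh
    refine ⟨Ψ.symm h, fun i => ?_, Ψ.apply_symm_apply h⟩
    obtain ⟨a, ha, hE⟩ := hh (ν i)
    have h2 := hlie i (Ψ.symm h)
    rw [Ψ.apply_symm_apply, hE] at h2
    rwa [← smul_left_injective ℝ (KacMoody.genE_ne_zero hGCM (ν i)) h2]

end WeylChamber

/-! ### Sets of roots in a Euclidean space -/

/-- A set of nonzero vectors in a Euclidean space that is stable under its reflections and satisfies
the integrality condition. -/
structure IsRootSet {V : Type*} [AddCommGroup V] [Module ℝ V] (B : LinearMap.BilinForm ℝ V)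
    (R : Set V) : Prop where
  symm : ∀ x y, B x y = B y x
  pos : ∀ x, x ≠ 0 → 0 < B x x
  zero_notMem : (0 : V) ∉ R
  reflect : ∀ x ∈ R, ∀ y ∈ R, ∃ k : ℤ, 2 * B x y = k * B x x ∧ y - (k : ℝ) • x ∈ R

section RootSet

variable {V : Type*} [AddCommGroup V] [Module ℝ V] {B : LinearMap.BilinForm ℝ V} {R : Set V}

theorem IsRootSet.ne_zero (h : IsRootSet B R) {x : V} (hx : x ∈ R) : x ≠ 0 := fun h0 =>
  h.zero_notMem (h0 ▸ hx)

theorem IsRootSet.reflect_eq (h : IsRootSet B R) {x y : V} (hx : x ∈ R) (hy : y ∈ R) (c : ℝ)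
    (hc : 2 * B x y = c * B x x) : y - c • x ∈ R := by
  obtain ⟨k, hk, hmem⟩ := h.reflect x hx y hy
  have : (k : ℝ) = c := mul_right_cancel₀ (h.pos x (h.ne_zero hx)).ne' (hk.symm.trans hc)
  rwa [← this]

theorem IsRootSet.neg_mem (h : IsRootSet B R) {x : V} (hx : x ∈ R) : -x ∈ R := by
  have := h.reflect_eq hx hx 2 rfl
  rwa [two_smul, sub_add_cancel_left] at this

/-! ### Simple systems, heights and the highest root. -/

section Simple

variable {r : ℕ} {b : Basis (Fin r) ℝ V} {θ : V}

theorem repr_nonneg_of_mem_closure {x : V} (hx : x ∈ AddSubmonoid.closure (Set.range b))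
    (i : Fin r) : 0 ≤ b.repr x i := by
  induction hx using AddSubmonoid.closure_induction with
  | mem x hx =>
    obtain ⟨j, rfl⟩ := hx
    rw [b.repr_self, Finsupp.single_apply]
    split_ifs <;> simp
  | zero => simp
  | add x y _ _ hx hy => simpa using add_nonneg hx hy

theorem eq_zero_of_mem_closure_of_neg_mem {x : V} (hx : x ∈ AddSubmonoid.closure (Set.range b))
    (hx' : -x ∈ AddSubmonoid.closure (Set.range b)) : x = 0 := by
  refine b.repr.injective (Finsupp.ext fun i => ?_)
  have h1 := repr_nonneg_of_mem_closure hx i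
  have h2 := repr_nonneg_of_mem_closure hx' i
  simp only [map_neg, Finsupp.neg_apply] at h2
  simpa using le_antisymm (by linarith) h1

/-- The height function of a basis. -/
def height (b : Basis (Fin r) ℝ V) : V →ₗ[ℝ] ℝ := ∑ i, b.coord i

theorem height_basis (i : Fin r) : height b (b i) = 1 := by
  simp [height, Finsupp.single_apply]

theorem height_nonneg {x : V} (hx : x ∈ AddSubmonoid.closure (Set.range b)) : 0 ≤ height b x := by
  simpa [height] using Finset.sum_nonneg fun i _ => repr_nonneg_of_mem_closure hx i

theorem eq_zero_of_height_nonpos {x : V} (hx : x ∈ AddSubmonoid.closure (Set.range b))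
    (h : height b x ≤ 0) : x = 0 := by
  have h0 : ∑ i, b.repr x i = 0 := le_antisymm (by simpa [height] using h)
    (Finset.sum_nonneg fun i _ => repr_nonneg_of_mem_closure hx i)
  rw [Finset.sum_eq_zero_iff_of_nonneg fun i _ => repr_nonneg_of_mem_closure hx i] at h0
  exact b.repr.injective (Finsupp.ext fun i => by simpa using h0 i (Finset.mem_univ i))

theorem IsSimpleSystem.height_ne_zero (hb : IsSimpleSystem R b) (h : IsRootSet B R) {x : V}
    (hx : x ∈ R) : height b x ≠ 0 := by
  intro h0
  rcases hb.2.2 x hx with h1 | h1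
  · exact h.ne_zero hx (eq_zero_of_height_nonpos h1 h0.le)
  · exact h.ne_zero hx (neg_eq_zero.1 (eq_zero_of_height_nonpos h1 (by simp [h0])))

theorem IsSimpleSystem.mem_closure_of_height_pos (hb : IsSimpleSystem R b) {x : V}
    (hx : x ∈ R) (hpos : 0 < height b x) : x ∈ AddSubmonoid.closure (Set.range b) := by
  rcases hb.2.2 x hx with h1 | h1
  · exact h1
  · have := height_nonneg h1
    rw [map_neg] at this
    linarith

/-- The reflected root `b j - k • b i` has coefficients `1` and `-k`; a root cannot have
coefficients of both signs, so `k ≤ 0`. -/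
theorem IsSimpleSystem.form_nonpos (hb : IsSimpleSystem R b) (h : IsRootSet B R) {i j : Fin r}
    (hij : i ≠ j) : B (b i) (b j) ≤ 0 := by
  obtain ⟨k, hk, hmem⟩ := h.reflect _ (hb.2.1 i) _ (hb.2.1 j)
  have hpos := h.pos _ (b.ne_zero i)
  have hk0 : (k : ℝ) ≤ 0 := by
    rcases hb.2.2 _ hmem with h1 | h1
    · have := repr_nonneg_of_mem_closure h1 i
      simp [hij] at this
      exact_mod_cast this
    · have := repr_nonneg_of_mem_closure h1 j
      simp [hij] at this
      linarith
  nlinarith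

/-- Reflecting `θ` in `b i` gives the root `θ - k • b i`, and `θ` minus this root is `k • b i`, so
`k ≥ 0`. -/
theorem IsHighestRoot.form_nonneg (hθ : IsHighestRoot R b θ) (hb : IsSimpleSystem R b)
    (h : IsRootSet B R) (i : Fin r) : 0 ≤ B (b i) θ := by
  obtain ⟨k, hk, hmem⟩ := h.reflect _ (hb.2.1 i) _ hθ.1
  have hpos := h.pos _ (b.ne_zero i)
  have h1 := repr_nonneg_of_mem_closure (hθ.2 _ hmem) i
  have hk0 : (0 : ℝ) ≤ k := by simpa using h1
  nlinarith

/-- The full support of `θ` takes the place of irreducibility of the root system in what follows. -/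
theorem IsHighestRoot.one_le_repr (hθ : IsHighestRoot R b θ) (hb : IsSimpleSystem R b)
    (i : Fin r) : 1 ≤ b.repr θ i := by
  simpa using repr_nonneg_of_mem_closure (hθ.2 _ (hb.2.1 i)) i

theorem IsHighestRoot.rank_pos (hθ : IsHighestRoot R b θ) (h : IsRootSet B R) : 0 < r := by
  rcases Nat.eq_zero_or_pos r with rfl | hr
  · have : Subsingleton V := b.repr.toEquiv.subsingleton
    exact absurd (Subsingleton.elim θ 0) (h.ne_zero hθ.1)
  · exact hr

theorem IsHighestRoot.mem_closure (hθ : IsHighestRoot R b θ) (hb : IsSimpleSystem R b)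
    (h : IsRootSet B R) : θ ∈ AddSubmonoid.closure (Set.range b) := by
  rcases hb.2.2 _ hθ.1 with h1 | h1
  · exact h1
  · have h2 := repr_nonneg_of_mem_closure h1 ⟨0, hθ.rank_pos h⟩
    have h3 := hθ.one_le_repr hb ⟨0, hθ.rank_pos h⟩
    simp only [map_neg, Finsupp.neg_apply] at h2
    linarith

/-! ### Root systems whose highest root is divisible -/

/-- The short roots of a root system of type `bc`, whose highest root is `2ε`. -/
def shortRoots (B : LinearMap.BilinForm ℝ V) (R : Set V) (ε : V) : Set V :=
  {μ | μ = ε ∨ μ = -ε ∨ (B ε μ = 0 ∧ μ ≠ 0 ∧ ε + μ ∈ R)}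

variable {ε : V}

/-- Reflecting `ε` in `ε + μ` gives an integer `k` with `1 = k (1/2 + B μ μ)`. Hence `0 < k < 2`, so
`k = 1`: this fixes the norm of `μ`, and the reflected root is `-μ`. The same reflection takes `2ε`
to `-2μ`, and the reflection in `μ` takes `ε + μ` to `ε - μ`. -/
theorem IsRootSet.form_of_orthogonal (h : IsRootSet B R) (hε : ε ∈ R) (hε2 : (2 : ℝ) • ε ∈ R)
    (hn : B ε ε = 1 / 2) {μ : V} (h1 : B ε μ = 0) (h2 : μ ≠ 0) (h3 : ε + μ ∈ R) :
    B μ μ = 1 / 2 ∧ μ ∈ R ∧ (2 : ℝ) • μ ∈ R ∧ ε - μ ∈ R := by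
  have h1' : B μ ε = 0 := by rw [h.symm, h1]
  have hμ := h.pos μ h2
  have hl : B (ε + μ) (ε + μ) = 1 / 2 + B μ μ := by simp [h1, h1', hn]
  obtain ⟨k, hk, hmem⟩ := h.reflect _ h3 _ hε
  have hk' : (1 : ℝ) = k * (1 / 2 + B μ μ) := by
    rw [← hl, ← hk]
    simp [h1', hn]
  have k0 : (0 : ℝ) < k := by
    by_contra hc
    nlinarith
  have k2 : (k : ℝ) < 2 := by nlinarith
  have hk1 : k = 1 := by
    have a1 : 0 < k := by exact_mod_cast k0
    have a2 : k < 2 := by exact_mod_cast k2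
    omega
  subst hk1
  have hμμ : B μ μ = 1 / 2 := by push_cast at hk'; linarith
  have hμR : μ ∈ R := by
    have := h.neg_mem hmem
    simpa using this
  refine ⟨hμμ, hμR, ?_, ?_⟩
  · have := h.neg_mem (h.reflect_eq h3 hε2 2 (by simp [h1, h1', hn, hμμ]; norm_num))
    rwa [← smul_sub, ← smul_neg, sub_add_cancel_left, neg_neg] at this
  · have := h.reflect_eq hμR h3 2 (by simp [h1', hμμ])
    convert! this using 1
    module

theorem IsRootSet.shortRoots_props (h : IsRootSet B R) (hε : ε ∈ R) (hε2 : (2 : ℝ) • ε ∈ R)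
    (hn : B ε ε = 1 / 2) {μ : V} (hμ : μ ∈ shortRoots B R ε) :
    B μ μ = 1 / 2 ∧ μ ∈ R ∧ (2 : ℝ) • μ ∈ R ∧ -μ ∈ shortRoots B R ε := by
  rcases hμ with rfl | rfl | ⟨h1, h2, h3⟩
  · exact ⟨hn, hε, hε2, Or.inr (Or.inl rfl)⟩
  · refine ⟨by simpa using hn, h.neg_mem hε, ?_, Or.inl (neg_neg _)⟩
    rw [smul_neg]
    exact h.neg_mem hε2
  · obtain ⟨a1, a2, a3, a4⟩ := h.form_of_orthogonal hε hε2 hn h1 h2 h3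
    exact ⟨a1, a2, a3, Or.inr (Or.inr ⟨by simp [h1], neg_ne_zero.2 h2, by
      rwa [← sub_eq_add_neg]⟩)⟩

theorem IsRootSet.shortRoots_orthogonal (h : IsRootSet B R) (hε : ε ∈ R)
    (hε2 : (2 : ℝ) • ε ∈ R) (hn : B ε ε = 1 / 2) {μ μ' : V} (hμ : μ ∈ shortRoots B R ε)
    (hμ' : μ' ∈ shortRoots B R ε) : B μ μ' = 0 ∨ μ' = μ ∨ μ' = -μ := by
  obtain ⟨a1, a2, a3, -⟩ := h.shortRoots_props hε hε2 hn hμ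
  obtain ⟨b1, b2, -, -⟩ := h.shortRoots_props hε hε2 hn hμ'
  -- Reflecting in `2μ` instead of `μ` sharpens integrality to `B μ μ' ∈ ½ℤ`. The norms `1 ∓ k` of
  -- `μ' ∓ μ` then leave only `k = 0`, unless `μ' = ±μ`.
  obtain ⟨k, hk, -⟩ := h.reflect _ a3 _ b2
  have hk' : B μ μ' = k / 2 := by
    simp only [map_smul, LinearMap.smul_apply, smul_eq_mul, a1] at hk
    linarith
  have hs := h.symm μ' μ
  have hsub : B (μ' - μ) (μ' - μ) = 1 - k := by
    simp only [map_sub, LinearMap.sub_apply, a1, b1, hs, hk']; ring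
  have hadd : B (μ' + μ) (μ' + μ) = 1 + k := by
    simp only [map_add, LinearMap.add_apply, a1, b1, hs, hk']; ring
  by_cases e1 : μ' - μ = 0
  · exact Or.inr (Or.inl (sub_eq_zero.1 e1))
  by_cases e2 : μ' + μ = 0
  · exact Or.inr (Or.inr (eq_neg_of_add_eq_zero_left e2))
  have p1 := h.pos _ e1
  have p2 := h.pos _ e2
  rw [hsub] at p1
  rw [hadd] at p2
  have q1 : k < 1 := by exact_mod_cast (by linarith : (k : ℝ) < 1)
  have q2 : -1 < k := by exact_mod_cast (by linarith : (-1 : ℝ) < k)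
  have : k = 0 := by omega
  left
  simp [hk', this]

theorem IsRootSet.add_mem_of_shortRoots (h : IsRootSet B R) (hε : ε ∈ R)
    (hε2 : (2 : ℝ) • ε ∈ R) (hn : B ε ε = 1 / 2) {μ μ' : V} (hμ : μ ∈ shortRoots B R ε)
    (hμ' : μ' ∈ shortRoots B R ε) (horth : B μ μ' = 0) : μ + μ' ∈ R := by
  have hεmem : ∀ ν ∈ shortRoots B R ε, B ε ν = 0 → ε + ν ∈ R := by
    rintro ν (rfl | rfl | ⟨-, -, h3⟩) h0
    · rw [hn] at h0; norm_num at h0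
    · rw [map_neg, hn] at h0; norm_num at h0
    · exact h3
  have hεneg : ∀ ν ∈ shortRoots B R ε, B ε ν = 0 → -ε + ν ∈ R := by
    intro ν hν h0
    have := h.neg_mem (hεmem (-ν) (h.shortRoots_props hε hε2 hn hν).2.2.2 (by simp [h0]))
    rwa [neg_add, neg_neg] at this
  have key : ∀ ν ν' : V, (ν = ε ∨ ν = -ε) → ν' ∈ shortRoots B R ε → B ν ν' = 0 → ν + ν' ∈ R := by
    rintro ν ν' (rfl | rfl) hν' h0
    · exact hεmem _ hν' h0
    · exact hεneg _ hν' (by simpa using h0)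
  by_cases c1 : μ = ε ∨ μ = -ε
  · exact key _ _ c1 hμ' horth
  by_cases c2 : μ' = ε ∨ μ' = -ε
  · rw [add_comm]
    exact key _ _ c2 hμ (by rw [h.symm, horth])
  obtain ⟨k1, k2, k3⟩ := (or_assoc.2 hμ').resolve_left c2
  obtain ⟨l1, -, l3⟩ := (or_assoc.2 hμ).resolve_left c1
  obtain ⟨a1, -, -, a4⟩ := h.form_of_orthogonal hε hε2 hn k1 k2 k3
  -- When neither vector is `±ε`, the reflection in `ε - μ'` takes `ε + μ` to `μ + μ'`.
  have := h.reflect_eq a4 l3 1 (by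
    have s2 := h.symm μ' ε
    have s3 := h.symm μ' μ
    simp only [map_sub, map_add, LinearMap.sub_apply, s2, s3, k1, l1, horth, hn, a1]
    norm_num)
  convert! this using 1
  module

/-- Every root is one of `±eᵢ`, `±2eᵢ`, `±eᵢ ± eⱼ`, or orthogonal to all short roots. -/
theorem IsHighestRoot.root_cases (h : IsRootSet B R) (hb : IsSimpleSystem R b)
    (hθ : IsHighestRoot R b ((2 : ℝ) • ε)) (hε : ε ∈ R) (hn : B ε ε = 1 / 2) {β : V}
    (hβ : β ∈ R) :
    (∃ μ ∈ shortRoots B R ε, β = μ ∨ β = (2 : ℝ) • μ) ∨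
    (∃ μ ∈ shortRoots B R ε, ∃ μ' ∈ shortRoots B R ε, B μ μ' = 0 ∧ β = μ + μ') ∨
    ∀ μ ∈ shortRoots B R ε, B β μ = 0 := by
  have hε2 := hθ.1
  have hneg : ∀ μ ∈ shortRoots B R ε, -μ ∈ shortRoots B R ε := fun μ hμ =>
    (h.shortRoots_props hε hε2 hn hμ).2.2.2
  have hεs : ε ∈ shortRoots B R ε := Or.inl rfl
  have hpos : ∀ β ∈ R, 0 < B ε β → (∃ μ ∈ shortRoots B R ε, β = μ ∨ β = (2 : ℝ) • μ) ∨
      (∃ μ ∈ shortRoots B R ε, ∃ μ' ∈ shortRoots B R ε, B μ μ' = 0 ∧ β = μ + μ') := by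
    intro β hβ hβε
    obtain ⟨k, hk, hmem⟩ := h.reflect _ hε2 _ hβ
    simp only [map_smul, LinearMap.smul_apply, smul_eq_mul, hn] at hk
    have hk' : B ε β = k / 2 := by linarith
    have k0 : 0 < k := by exact_mod_cast (by linarith : (0 : ℝ) < k)
    let i : Fin r := ⟨0, hθ.rank_pos h⟩
    have hr := hθ.one_le_repr hb i
    have t1 := repr_nonneg_of_mem_closure (hθ.2 _ (h.neg_mem hmem)) i
    have t2 := repr_nonneg_of_mem_closure (hθ.2 _ hβ) i
    simp only [map_sub, map_neg, Finsupp.sub_apply, Finsupp.neg_apply, map_smul,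
      Finsupp.smul_apply, smul_eq_mul] at t1 t2 hr
    -- Both `β` and `2kε - β` are roots, so `2ε` dominates each. Adding the two inequalities gives
    -- `(4 - 2k) ε ≥ 0` coefficientwise, while `2ε` has coefficients at least 1.
    have k3 : (k : ℝ) < 3 := by
      by_contra hc
      nlinarith
    have k3' : k < 3 := by exact_mod_cast k3
    have hk12 : k = 1 ∨ k = 2 := by omega
    rcases hk12 with rfl | rfl
    · by_cases h0 : β - ε = 0
      · exact Or.inl ⟨ε, hεs, Or.inl (sub_eq_zero.1 h0)⟩
      · have ho : B ε (β - ε) = 0 := by rw [map_sub, hk', hn]; norm_num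
        exact Or.inr ⟨ε, hεs, β - ε, Or.inr (Or.inr ⟨ho, h0, by simpa using hβ⟩), ho, by simp⟩
    -- For `k = 2` the two domination inequalities read `2ε - β ≥ 0` and `β - 2ε ≥ 0`.
    · left
      refine ⟨ε, hεs, Or.inr ?_⟩
      have c1 := hθ.2 _ hβ
      have c2 := hθ.2 _ (h.neg_mem hmem)
      have : -((2 : ℝ) • ε - β) ∈ AddSubmonoid.closure (Set.range b) := by
        convert! c2 using 1
        push_cast
        module
      exact (sub_eq_zero.1 (eq_zero_of_mem_closure_of_neg_mem c1 this)).symm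
  rcases lt_trichotomy (B ε β) 0 with hlt | h0 | hgt
  · rcases hpos (-β) (h.neg_mem hβ) (by simpa using hlt) with ⟨μ, hμ, e⟩ | ⟨μ, hμ, μ', hμ', ho, e⟩
    · refine Or.inl ⟨-μ, hneg μ hμ, ?_⟩
      rw [smul_neg, ← neg_eq_iff_eq_neg, ← neg_eq_iff_eq_neg]
      exact e
    · refine Or.inr (Or.inl ⟨-μ, hneg μ hμ, -μ', hneg μ' hμ', by simpa using ho, ?_⟩)
      rw [← neg_add, ← e, neg_neg]
  · by_cases hall : ∀ μ ∈ shortRoots B R ε, B β μ = 0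
    · exact Or.inr (Or.inr hall)
    push Not at hall
    obtain ⟨μ, hμ, hne⟩ := hall
    rcases hμ with rfl | rfl | ⟨l1, l2, l3⟩
    · exact absurd (by rw [h.symm, h0]) hne
    · exact absurd (by rw [map_neg, h.symm, h0, neg_zero]) hne
    have hμ : μ ∈ shortRoots B R ε := Or.inr (Or.inr ⟨l1, l2, l3⟩)
    obtain ⟨a1, a2, a3, -⟩ := h.form_of_orthogonal hε hε2 hn l1 l2 l3
    -- As `β` is orthogonal to `ε`, reflecting `ε + μ` in `β` gives `ε + (μ - kβ)`, so `μ - kβ` is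
    -- again short. By `shortRoots_orthogonal` it is orthogonal to `μ` or equal to `±μ`.
    -- Respectively, `β` is a signed difference of orthogonal short roots, a contradiction arises,
    -- or `kβ = 2μ`.
    obtain ⟨k, hk, hmem⟩ := h.reflect _ hβ _ l3
    have hs : B β ε = 0 := by rw [h.symm, h0]
    have hs' := h.symm μ β
    rw [map_add, hs, zero_add] at hk
    have hββ := h.pos β (h.ne_zero hβ)
    have hn2 : B (μ - (k : ℝ) • β) (μ - (k : ℝ) • β) = 1 / 2 := by
      simp only [map_sub, map_smul, LinearMap.sub_apply, LinearMap.smul_apply, smul_eq_mul, a1, hs']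
      linear_combination (-(k : ℝ)) * hk
    have hμ2 : μ - (k : ℝ) • β ∈ shortRoots B R ε := by
      refine Or.inr (Or.inr ⟨by simp [l1, h0], ?_, ?_⟩)
      · intro e
        rw [e] at hn2
        norm_num at hn2
      · rwa [← add_sub_assoc]
    obtain ⟨m, hm, -⟩ := h.reflect _ a3 _ hβ
    simp only [map_smul, LinearMap.smul_apply, smul_eq_mul, a1, hs'] at hm
    have hm' : B β μ = m / 2 := by linarith
    have hinner : B μ (μ - (k : ℝ) • β) = 1 / 2 - k * m / 2 := by
      simp only [map_sub, map_smul, smul_eq_mul, a1, hs', hm']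
      ring
    rcases h.shortRoots_orthogonal hε hε2 hn hμ hμ2 with e | e | e
    · rw [hinner] at e
      have hkm : k * m = 1 := by exact_mod_cast (by linarith : (k : ℝ) * m = 1)
      refine Or.inr (Or.inl ?_)
      rcases Int.eq_one_or_neg_one_of_mul_eq_one hkm with rfl | rfl
      · refine ⟨μ, hμ, _, hneg _ hμ2, ?_, ?_⟩
        · rw [map_neg, hinner]; linarith
        · push_cast; module
      · refine ⟨-μ, hneg _ hμ, _, hμ2, ?_, ?_⟩
        · rw [map_neg, LinearMap.neg_apply, hinner]; linarith
        · push_cast; module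
    · exfalso
      rw [sub_eq_self, smul_eq_zero, or_iff_left (h.ne_zero hβ)] at e
      rw [e, zero_mul] at hk
      exact hne (by linarith)
    · have hkβ : (k : ℝ) • β = (2 : ℝ) • μ := by
        rw [sub_eq_iff_eq_add] at e
        rw [two_smul]
        nth_rw 1 [e]
        abel
      rw [e, map_neg, a1] at hinner
      have hkm : k * m = 2 := by exact_mod_cast (by linarith : (k : ℝ) * m = 2)
      have hdvd : k ∣ 2 := ⟨m, hkm.symm⟩
      have hk2 : k ≤ 2 := Int.le_of_dvd two_pos hdvd
      have hk2' : -k ≤ 2 := Int.le_of_dvd two_pos ((neg_dvd).2 hdvd)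
      have hk0 : k ≠ 0 := by rintro rfl; simp at hkm
      left
      have hk4 : k = 1 ∨ k = -1 ∨ k = 2 ∨ k = -2 := by omega
      rcases hk4 with rfl | rfl | rfl | rfl
      · exact ⟨μ, hμ, Or.inr (by simpa using hkβ)⟩
      · refine ⟨-μ, hneg _ hμ, Or.inr ?_⟩
        rw [smul_neg, ← hkβ]
        simp
      · refine ⟨μ, hμ, Or.inl ?_⟩
        exact smul_right_injective V (two_ne_zero (α := ℝ)) (by simpa using hkβ)
      · refine ⟨-μ, hneg _ hμ, Or.inl ?_⟩
        refine smul_right_injective V (two_ne_zero (α := ℝ)) ?_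
        simp only [smul_neg, ← hkβ]
        push_cast
        module
  · rcases hpos β hβ hgt with h1 | h1
    · exact Or.inl h1
    · exact Or.inr (Or.inl h1)

/-- Each root lies in the span `U` or is orthogonal to it. Since `θ ∈ U`, the part of `θ` carried by
simple roots outside `U` is in `U` and orthogonal to `U`, hence zero. But every simple root occurs
in `θ`, so none lies outside. -/
theorem IsHighestRoot.span_shortRoots (h : IsRootSet B R) (hb : IsSimpleSystem R b)
    (hθ : IsHighestRoot R b ((2 : ℝ) • ε)) (hε : ε ∈ R) (hn : B ε ε = 1 / 2) :
    Submodule.span ℝ (shortRoots B R ε) = ⊤ := by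
  classical
  set U := Submodule.span ℝ (shortRoots B R ε) with hU
  have hsub : ∀ μ ∈ shortRoots B R ε, μ ∈ U := fun μ hμ => Submodule.subset_span hμ
  have hcase : ∀ β ∈ R, β ∈ U ∨ ∀ μ ∈ shortRoots B R ε, B β μ = 0 := by
    intro β hβ
    rcases hθ.root_cases h hb hε hn hβ with ⟨μ, hμ, rfl | rfl⟩ | ⟨μ, hμ, μ', hμ', -, rfl⟩ | h3
    · exact Or.inl (hsub _ hμ)
    · exact Or.inl (U.smul_mem _ (hsub _ hμ))
    · exact Or.inl (U.add_mem (hsub _ hμ) (hsub _ hμ'))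
    · exact Or.inr h3
  have hperp : ∀ y, (∀ μ ∈ shortRoots B R ε, B y μ = 0) → y ∈ U → y = 0 := by
    intro y hy hyU
    by_contra hne
    have hle : U ≤ LinearMap.ker (B y) := Submodule.span_le.2 hy
    exact (h.pos y hne).ne' (hle hyU)
  let S : Finset (Fin r) := Finset.univ.filter fun i => b i ∈ U
  set θ := (2 : ℝ) • ε with hθdef
  have hθU : θ ∈ U := U.smul_mem _ (hsub ε (Or.inl rfl))
  have hsum : ∑ i ∈ Sᶜ, b.repr θ i • b i = 0 := by
    refine hperp _ ?_ ?_
    · intro μ hμ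
      rw [map_sum, LinearMap.sum_apply]
      refine Finset.sum_eq_zero fun i hi => ?_
      have hiU : b i ∉ U := by simpa [S] using hi
      rw [map_smul, LinearMap.smul_apply, (hcase _ (hb.2.1 i)).resolve_left hiU μ hμ, smul_zero]
    · have h1 := Finset.sum_add_sum_compl S fun i => b.repr θ i • b i
      rw [b.sum_repr, ← eq_sub_iff_add_eq'] at h1
      rw [h1]
      refine U.sub_mem hθU (U.sum_mem fun i hi => U.smul_mem _ ?_)
      simpa [S] using hi
  have hall : ∀ i, b i ∈ U := by
    intro i
    by_contra hi
    have hli := linearIndependent_iff'.1 b.linearIndependent _ _ hsum i (by simpa [S] using hi)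
    have := hθ.one_le_repr hb i
    rw [hli] at this
    norm_num at this
  rw [eq_top_iff, ← b.span_eq]
  refine Submodule.span_le.2 ?_
  rintro _ ⟨i, rfl⟩
  exact hall i

end Simple

end RootSet

/-! ### Root systems of type `bc` in orthogonal coordinates. -/

section BC

variable {V : Type*} [AddCommGroup V] [Module ℝ V] {B : LinearMap.BilinForm ℝ V} {R : Set V}
  {r : ℕ} {b : Basis (Fin r) ℝ V} {ε : V}

/-- The vector `x` is one of `±uᵢ`, `±2uᵢ`, `±uᵢ ± uⱼ` (`i ≠ j`). -/
def IsBCVector (u : Fin r → V) (x : V) : Prop :=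
  (∃ i, ∃ s : ℝ, (s = 1 ∨ s = -1) ∧ (x = s • u i ∨ x = (2 * s) • u i)) ∨
  ∃ i j, i ≠ j ∧ ∃ s t : ℝ, (s = 1 ∨ s = -1) ∧ (t = 1 ∨ t = -1) ∧ x = s • u i + t • u j

/-- A root system with divisible highest root is of type `bc`; the short positive roots form an
orthogonal basis, which can be numbered by increasing height. -/
theorem IsHighestRoot.exists_bc_basis (h : IsRootSet B R) (hb : IsSimpleSystem R b)
    (hθ : IsHighestRoot R b ((2 : ℝ) • ε)) (hε : ε ∈ R) (hn : B ε ε = 1 / 2) :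
    ∃ u : Basis (Fin r) ℝ V, (∀ i j, B (u i) (u j) = if i = j then 1 / 2 else 0) ∧
      (∀ x, x ∈ R ↔ IsBCVector u x) ∧ (∀ i, 0 < height b (u i)) ∧
      StrictMono fun i => height b (u i) := by
  classical
  have hε2 := hθ.1
  have hspan := hθ.span_shortRoots h hb hε hn
  have hprops := fun μ hμ => h.shortRoots_props hε hε2 hn (μ := μ) hμ
  let P : Type _ := {μ // μ ∈ shortRoots B R ε ∧ 0 < height b μ}
  have horth : ∀ μ ν : P, μ ≠ ν → B μ.1 ν.1 = 0 := by
    intro μ ν hne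
    rcases h.shortRoots_orthogonal hε hε2 hn μ.2.1 ν.2.1 with e | e | e
    · exact e
    · exact absurd (Subtype.ext e.symm) hne
    · have h1 := μ.2.2
      have h2 := ν.2.2
      rw [e, map_neg] at h2
      linarith
  have hsign : ∀ μ ∈ shortRoots B R ε, ∃ p : P, μ = p.1 ∨ μ = -p.1 := by
    intro μ hμ
    rcases lt_or_gt_of_ne (hb.height_ne_zero h (hprops μ hμ).2.1) with hlt | hgt
    · exact ⟨⟨-μ, (hprops μ hμ).2.2.2, by simpa using hlt⟩, Or.inr (neg_neg μ).symm⟩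
    · exact ⟨⟨μ, hμ, hgt⟩, Or.inl rfl⟩
  have hli : LinearIndependent ℝ (fun p : P => p.1) := by
    refine LinearMap.linearIndependent_of_isOrthoᵢ (B := B) (fun μ ν hne => horth μ ν hne) ?_
    intro p hp
    have := (hprops p.1 p.2.1).1
    rw [show B p.1 p.1 = 0 from hp] at this
    norm_num at this
  have htop : ⊤ ≤ Submodule.span ℝ (Set.range fun p : P => p.1) := by
    rw [← hspan]
    refine Submodule.span_le.2 fun μ hμ => ?_
    obtain ⟨p, e | e⟩ := hsign μ hμ
    · rw [e]; exact Submodule.subset_span ⟨p, rfl⟩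
    · rw [e]; exact Submodule.neg_mem _ (Submodule.subset_span ⟨p, rfl⟩)
  let v : Basis P ℝ V := Basis.mk hli htop
  have hv : ∀ p, v p = p.1 := fun p => Basis.mk_apply hli htop p
  let w : Basis (Fin r) ℝ V := v.reindex (v.indexEquiv b)
  have hw : ∀ i, w i = ((v.indexEquiv b).symm i).1 := fun i => by
    rw [Basis.reindex_apply, hv]
  let π := Tuple.sort fun i => height b (w i)
  let u : Basis (Fin r) ℝ V := w.reindex π.symm
  have hu : ∀ i, u i = ((v.indexEquiv b).symm (π i)).1 := fun i => by
    rw [Basis.reindex_apply, hw, Equiv.symm_symm]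
  have humem : ∀ i, u i ∈ shortRoots B R ε := fun i => by
    rw [hu]; exact ((v.indexEquiv b).symm (π i)).2.1
  have hpos : ∀ i, 0 < height b (u i) := fun i => by
    rw [hu]; exact ((v.indexEquiv b).symm (π i)).2.2
  have hgram : ∀ i j, B (u i) (u j) = if i = j then 1 / 2 else 0 := by
    intro i j
    split_ifs with hij
    · subst hij
      exact (hprops _ (humem i)).1
    · rw [hu, hu]
      refine horth _ _ fun e => hij ?_
      exact π.injective ((v.indexEquiv b).symm.injective e)
  have hsurj : ∀ μ ∈ shortRoots B R ε, ∃ i, ∃ s : ℝ, (s = 1 ∨ s = -1) ∧ μ = s • u i := by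
    intro μ hμ
    obtain ⟨p, hp⟩ := hsign μ hμ
    have hpu : u (π.symm (v.indexEquiv b p)) = p.1 := by
      rw [hu]; simp
    refine ⟨π.symm (v.indexEquiv b p), ?_⟩
    rw [hpu]
    rcases hp with e | e
    · exact ⟨1, Or.inl rfl, by simpa using e⟩
    · exact ⟨-1, Or.inr rfl, by simpa using e⟩
  have hsmem : ∀ i (s : ℝ), (s = 1 ∨ s = -1) → s • u i ∈ shortRoots B R ε := by
    rintro i s (rfl | rfl)
    · simpa using humem i
    · simpa using (hprops _ (humem i)).2.2.2
  have hadd : ∀ i j, i ≠ j → ∀ s t : ℝ, (s = 1 ∨ s = -1) → (t = 1 ∨ t = -1) →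
      s • u i + t • u j ∈ R := by
    intro i j hij s t hs ht
    refine h.add_mem_of_shortRoots hε hε2 hn (hsmem i s hs) (hsmem j t ht) ?_
    simp [hgram, hij]
  have hroots : ∀ x, x ∈ R ↔ IsBCVector u x := by
    intro x
    constructor
    · intro hx
      rcases hθ.root_cases h hb hε hn hx with ⟨μ, hμ, e⟩ | ⟨μ, hμ, μ', hμ', ho, e⟩ | h3
      · obtain ⟨i, s, hs, rfl⟩ := hsurj μ hμ
        exact Or.inl ⟨i, s, hs, by rwa [mul_smul]⟩
      · obtain ⟨i, s, hs, rfl⟩ := hsurj μ hμ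
        obtain ⟨j, t, ht, rfl⟩ := hsurj μ' hμ'
        refine Or.inr ⟨i, j, ?_, s, t, hs, ht, e⟩
        rintro rfl
        rcases hs with rfl | rfl <;> rcases ht with rfl | rfl <;> norm_num [hgram] at ho
      -- The short roots span, so a root orthogonal to all of them would be orthogonal to itself.
      · exfalso
        have hle : Submodule.span ℝ (shortRoots B R ε) ≤ LinearMap.ker (B x) :=
          Submodule.span_le.2 h3
        rw [hspan] at hle
        exact (h.pos x (h.ne_zero hx)).ne' (hle Submodule.mem_top)
    · rintro (⟨i, s, hs, rfl | rfl⟩ | ⟨i, j, hij, s, t, hs, ht, rfl⟩)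
      · exact (hprops _ (hsmem i s hs)).2.1
      · rw [mul_smul]
        exact (hprops _ (hsmem i s hs)).2.2.1
      · exact hadd i j hij s t hs ht
  refine ⟨u, hgram, hroots, hpos, ?_⟩
  have hmono : Monotone fun i => height b (u i) := by
    have := Tuple.monotone_sort fun i => height b (w i)
    intro i j hij
    have h2 := this hij
    simpa only [Function.comp_apply, u, Basis.reindex_apply, Equiv.symm_symm] using! h2
  refine hmono.strictMono_of_injective fun i j hij => ?_
  by_contra hne
  -- Strictness: `u i - u j` is a root, so its height is not zero.
  have := hb.height_ne_zero h (hadd i j hne 1 (-1) (Or.inl rfl) (Or.inr rfl))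
  refine this ?_
  simp only [map_add, map_smul, smul_eq_mul]
  have hij' : height b (u i) = height b (u j) := hij
  rw [hij']
  ring

theorem isOfBCType_of_basis {u : Basis (Fin r) ℝ V} (hu : ∀ x, x ∈ R ↔ IsBCVector u x) :
    IsOfBCType R r := by
  refine ⟨u.equivFun, ?_⟩
  have hs : ∀ (i : Fin r) (s : ℝ), u.equivFun.symm (Pi.single i s) = s • u i := by
    intro i s
    rw [Basis.equivFun_symm_apply, Finset.sum_eq_single i] <;> simp +contextual
  have hmem : ∀ y, y ∈ u.equivFun '' R ↔ IsBCVector u (u.equivFun.symm y) := by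
    intro y
    rw [← hu]
    constructor
    · rintro ⟨x, hx, rfl⟩
      simpa using hx
    · intro hy
      exact ⟨_, hy, u.equivFun.apply_symm_apply y⟩
  ext y
  rw [hmem]
  constructor
  · rintro (⟨i, s, hs', e | e⟩ | ⟨i, j, hij, s, t, hs', ht, e⟩)
    · rw [← hs, u.equivFun.symm.injective.eq_iff] at e
      refine Or.inl (Or.inl ⟨i, ?_⟩)
      rcases hs' with rfl | rfl
      · exact Or.inl e
      · exact Or.inr e
    · rw [← hs, u.equivFun.symm.injective.eq_iff] at e
      refine Or.inr (Or.inl ⟨i, ?_⟩)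
      rcases hs' with rfl | rfl
      · exact Or.inl (by simpa using e)
      · exact Or.inr (by rw [e]; norm_num)
    · rw [← hs, ← hs, ← map_add, u.equivFun.symm.injective.eq_iff] at e
      exact Or.inl (Or.inr ⟨i, j, hij, s, hs', t, ht, e⟩)
  · have hd : y ∈ dRoots r → IsBCVector u (u.equivFun.symm y) := by
      rintro ⟨i, j, hij, s, hs', t, ht, rfl⟩
      exact Or.inr ⟨i, j, hij, s, t, hs', ht, by rw [map_add, hs, hs]⟩
    rintro ((⟨i, rfl | rfl⟩ | h1) | (⟨i, rfl | rfl⟩ | h1))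
    · exact Or.inl ⟨i, 1, Or.inl rfl, Or.inl (hs _ _)⟩
    · exact Or.inl ⟨i, -1, Or.inr rfl, Or.inl (hs _ _)⟩
    · exact hd h1
    · exact Or.inl ⟨i, 1, Or.inl rfl, Or.inr (by rw [hs, mul_one])⟩
    · exact Or.inl ⟨i, -1, Or.inr rfl, Or.inr (by rw [hs]; norm_num)⟩
    · exact hd h1

/-- The highest root of a root system of type `bc` is divisible. -/
theorem IsHighestRoot.half_mem_of_isOfBCType {n : ℕ} {θ : V} (hθ : IsHighestRoot R b θ)
    (hR : IsOfBCType R n) (h0 : (0 : V) ∉ R) : (1 / 2 : ℝ) • θ ∈ R := by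
  obtain ⟨f, hf⟩ := hR
  have hmem : ∀ x, x ∈ R ↔ f x ∈ bRoots n ∪ cRoots n := by
    intro x
    rw [← hf]
    exact ⟨fun hx => ⟨x, hx, rfl⟩, fun ⟨y, hy, e⟩ => f.injective e ▸ hy⟩
  have hlong : ∀ i (s : ℝ), (s = 1 ∨ s = -1) → f.symm (Pi.single i (2 * s)) ∈ R := by
    intro i s hs
    rw [hmem, LinearEquiv.apply_symm_apply]
    refine Or.inr (Or.inl ⟨i, ?_⟩)
    rcases hs with rfl | rfl
    · left; norm_num
    · right; norm_num
  have hshort : ∀ i (s : ℝ), (s = 1 ∨ s = -1) → f.symm (Pi.single i s) ∈ R := by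
    intro i s hs
    rw [hmem, LinearEquiv.apply_symm_apply]
    refine Or.inl (Or.inl ⟨i, ?_⟩)
    rcases hs with rfl | rfl <;> simp
  have hθ0 : θ ≠ 0 := fun e => h0 (e ▸ hθ.1)
  have two : ∀ i (s : ℝ), (Pi.single i (2 * s) : Fin n → ℝ) = (2 : ℝ) • Pi.single i s := by
    intro i s
    rw [← Pi.single_smul, smul_eq_mul]
  -- If `θ` were short, `2θ` and `-θ` would be roots. Then `θ - 2θ = -θ` and `θ + θ` are sums of
  -- simple roots, and so is their sum `θ`; this forces `θ = 0`.
  have hS : ∀ i (s : ℝ), (s = 1 ∨ s = -1) → f θ ≠ Pi.single i s := by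
    intro i s hs e
    have e' : θ = f.symm (Pi.single i s) := by rw [← e, LinearEquiv.symm_apply_apply]
    have h1 := hθ.2 _ (hlong i s hs)
    have h2 := hθ.2 _ (hshort i (-s) (by rcases hs with rfl | rfl <;> simp))
    rw [two, map_smul, ← e', two_smul, sub_add_cancel_left] at h1
    rw [Pi.single_neg, map_neg, ← e', sub_neg_eq_add] at h2
    have h3 := add_mem h1 h2
    rw [neg_add_cancel_left] at h3
    exact hθ0 (eq_zero_of_mem_closure_of_neg_mem h3 h1)
  -- If `θ = x + y` with `2x` and `2y` roots, then `θ - 2x = y - x` and `θ - 2y = x - y` are both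
  -- nonnegative, so `x = y`, contradicting `i ≠ j`.
  have hD : f θ ∉ dRoots n := by
    rintro ⟨i, j, hij, s, hs, t, ht, e⟩
    have e' : θ = f.symm (Pi.single i s) + f.symm (Pi.single j t) := by
      rw [← map_add, ← e, LinearEquiv.symm_apply_apply]
    have h1 := hθ.2 _ (hlong i s hs)
    have h2 := hθ.2 _ (hlong j t ht)
    rw [two, map_smul, e', two_smul, add_sub_add_left_eq_sub] at h1
    rw [two, map_smul, e', two_smul, add_sub_add_right_eq_sub] at h2
    have h3 := eq_zero_of_mem_closure_of_neg_mem h1 (by rwa [neg_sub])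
    rw [sub_eq_zero] at h3
    have h4 := congrFun (f.symm.injective h3) i
    rw [Pi.single_eq_same, Pi.single_eq_of_ne hij] at h4
    rcases hs with rfl | rfl <;> norm_num at h4
  have hL : ∀ i (s : ℝ), (s = 1 ∨ s = -1) → f θ = Pi.single i (2 * s) → (1 / 2 : ℝ) • θ ∈ R := by
    intro i s hs e
    have e' : θ = (2 : ℝ) • f.symm (Pi.single i s) := by
      rw [← map_smul, ← two, ← e, LinearEquiv.symm_apply_apply]
    rw [e', smul_smul]
    norm_num
    exact hshort i s hs
  rcases (hmem θ).1 hθ.1 with (⟨i, e | e⟩ | e) | (⟨i, e | e⟩ | e)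
  · exact absurd e (hS i 1 (Or.inl rfl))
  · exact absurd e (hS i (-1) (Or.inr rfl))
  · exact absurd e hD
  · exact hL i 1 (Or.inl rfl) (by rw [e]; norm_num)
  · exact hL i (-1) (Or.inr rfl) (by rw [e]; norm_num)
  · exact absurd e hD

/-! ### The simple roots of a root system of type `bc` -/

/-- The standard simple system, beginning with the short root. -/
def bcSimple (u : Fin r → V) (i : Fin r) : V :=
  if (i : ℕ) = 0 then u i else u i - u ⟨i - 1, by omega⟩

theorem mem_closure_bcSimple {W : Type*} [AddCommGroup W] (u : Fin r → W) (i : Fin r) :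
    u i ∈ AddSubmonoid.closure (Set.range (bcSimple u)) := by
  obtain ⟨k, hk⟩ := i
  induction k with
  | zero => exact AddSubmonoid.subset_closure ⟨⟨0, hk⟩, by simp [bcSimple]⟩
  | succ k ih =>
    have h1 := ih (by omega)
    have h2 : bcSimple u ⟨k + 1, hk⟩ ∈ AddSubmonoid.closure (Set.range (bcSimple u)) :=
      AddSubmonoid.subset_closure ⟨_, rfl⟩
    have := add_mem h2 h1
    simpa [bcSimple] using this

theorem sub_mem_closure_bcSimple {W : Type*} [AddCommGroup W] (u : Fin r → W) {i j : Fin r} (hij : j < i) :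
    u i - u j ∈ AddSubmonoid.closure (Set.range (bcSimple u)) := by
  obtain ⟨k, hk⟩ := i
  induction k with
  | zero => exact absurd hij (by simp [Fin.lt_def])
  | succ k ih =>
    have h2 : bcSimple u ⟨k + 1, hk⟩ ∈ AddSubmonoid.closure (Set.range (bcSimple u)) :=
      AddSubmonoid.subset_closure ⟨_, rfl⟩
    have h3 : bcSimple u ⟨k + 1, hk⟩ = u ⟨k + 1, hk⟩ - u ⟨k, by omega⟩ := by simp [bcSimple]
    rcases (Nat.lt_succ_iff.1 hij).lt_or_eq with hlt | heq
    · have := add_mem h2 (ih (by omega) hlt)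
      rwa [h3, sub_add_sub_cancel] at this
    · have hj : (⟨k, by omega⟩ : Fin r) = j := Fin.ext heq.symm
      rwa [h3, hj] at h2

theorem IsBCVector.mem_closure_bcSimple {u : Fin r → V} {f : V →ₗ[ℝ] ℝ} (hpos : ∀ i, 0 < f (u i))
    (hmono : StrictMono fun i => f (u i)) {x : V} (hx : IsBCVector u x) (hfx : 0 < f x) :
    x ∈ AddSubmonoid.closure (Set.range (bcSimple u)) := by
  have hu := _root_.mem_closure_bcSimple u
  have hsub : ∀ i j, 0 < f (u i) - f (u j) →
      u i - u j ∈ AddSubmonoid.closure (Set.range (bcSimple u)) := fun i j hij =>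
    sub_mem_closure_bcSimple u (hmono.lt_iff_lt.1 (sub_pos.1 hij))
  rcases hx with ⟨i, s, rfl | rfl, rfl | rfl⟩ | ⟨i, j, hij, s, t, rfl | rfl, rfl | rfl, rfl⟩
  · simpa using hu i
  · rw [mul_one, two_smul]; exact add_mem (hu i) (hu i)
  · simp only [map_smul, smul_eq_mul] at hfx; linarith [hpos i]
  · simp only [map_smul, smul_eq_mul] at hfx; linarith [hpos i]
  · simpa using add_mem (hu i) (hu j)
  · have := hsub i j (by simpa [sub_eq_add_neg] using hfx)
    simpa [sub_eq_add_neg] using this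
  · have := hsub j i (by simpa [sub_eq_add_neg, add_comm] using hfx)
    simpa [sub_eq_add_neg, add_comm] using this
  · simp only [map_add, map_smul, smul_eq_mul] at hfx; linarith [hpos i, hpos j]

theorem eq_zero_or_one_le_height {x : V} (hx : x ∈ AddSubmonoid.closure (Set.range b)) :
    x = 0 ∨ 1 ≤ height b x := by
  induction hx using AddSubmonoid.closure_induction with
  | mem x hx =>
    obtain ⟨i, rfl⟩ := hx
    exact Or.inr (height_basis i).ge
  | zero => exact Or.inl rfl
  | add x y _ _ hx hy =>
    rcases hx with rfl | hx <;> rcases hy with rfl | hy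
    · simp
    · exact Or.inr (by simpa using hy)
    · exact Or.inr (by simpa using hx)
    · exact Or.inr (by rw [map_add]; linarith)

/-- Simple roots are indivisible. -/
theorem IsSimpleSystem.half_notMem (hb : IsSimpleSystem R b) (i : Fin r) :
    (1 / 2 : ℝ) • b i ∉ R := by
  intro hi
  have hh : height b ((1 / 2 : ℝ) • b i) = 1 / 2 := by
    rw [map_smul, height_basis, smul_eq_mul, mul_one]
  rcases hb.2.2 _ hi with h1 | h1
  · rcases eq_zero_or_one_le_height h1 with h2 | h2
    · exact b.ne_zero i ((smul_eq_zero.1 h2).resolve_left (by norm_num))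
    · rw [hh] at h2
      norm_num at h2
  · have := height_nonneg h1
    rw [map_neg, hh] at this
    norm_num at this

/-- A basis is determined, up to numbering, by the additive monoid that it generates. -/
theorem exists_perm_of_closure {t : Fin r → V} (ht0 : ∀ i, t i ≠ 0)
    (ht : ∀ i, t i ∈ AddSubmonoid.closure (Set.range b))
    (hb : ∀ i, b i ∈ AddSubmonoid.closure (Set.range t)) :
    ∃ π : Equiv.Perm (Fin r), ∀ i, b i = t (π i) := by
  have h1' : ∀ i, 1 ≤ height b (t i) := fun i => (eq_zero_or_one_le_height (ht i)).resolve_left (ht0 i)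
  -- Every `t i` has height at least 1, so a nonzero sum that is not a single `t i` has height at
  -- least 2; each `b i` has height exactly 1.
  have h2 : ∀ x ∈ AddSubmonoid.closure (Set.range t),
      x = 0 ∨ (1 ≤ height b x ∧ ∃ i, x = t i) ∨ 2 ≤ height b x := by
    intro x hx
    induction hx using AddSubmonoid.closure_induction with
    | mem x hx =>
      obtain ⟨i, rfl⟩ := hx
      exact Or.inr (Or.inl ⟨h1' i, i, rfl⟩)
    | zero => exact Or.inl rfl
    | add x y _ _ hx hy =>
      rcases hx with rfl | hx
      · simpa using hy
      rcases hy with rfl | hy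
      · simpa using Or.inr hx
      have hx' : 1 ≤ height b x := by
        rcases hx with hx | hx
        · exact hx.1
        · linarith
      have hy' : 1 ≤ height b y := by
        rcases hy with hy | hy
        · exact hy.1
        · linarith
      exact Or.inr (Or.inr (by rw [map_add]; linarith))
  have h3 : ∀ i, ∃ j, b i = t j := by
    intro i
    rcases h2 _ (hb i) with h | h | h
    · exact absurd h (b.ne_zero i)
    · exact h.2
    · rw [height_basis] at h
      norm_num at h
  choose π hπ using h3
  have hinj : Function.Injective π := fun i j hij => b.injective (by rw [hπ, hπ, hij])
  exact ⟨Equiv.ofBijective π hinj.bijective_of_finite, hπ⟩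

/-- The simple roots and the highest root of a root system of type `bc`, in terms of an orthogonal
basis. -/
theorem IsHighestRoot.exists_bcSimple {b : Basis (Fin (r + 1)) ℝ V} {θ : V} (h : IsRootSet B R)
    (hb : IsSimpleSystem R b) (hθ : IsHighestRoot R b θ) (hdiv : (1 / 2 : ℝ) • θ ∈ R)
    (hn : B θ θ = 2) :
    ∃ (u : Basis (Fin (r + 1)) ℝ V) (π : Equiv.Perm (Fin (r + 1))),
      (∀ i j, B (u i) (u j) = if i = j then 1 / 2 else 0) ∧ (∀ i, b i = bcSimple u (π i)) ∧
      θ = (2 : ℝ) • u (Fin.last r) := by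
  have hθε : (2 : ℝ) • ((1 / 2 : ℝ) • θ) = θ := by rw [smul_smul]; norm_num
  obtain ⟨u, hgram, hroots, hpos, hmono⟩ := IsHighestRoot.exists_bc_basis (ε := (1 / 2 : ℝ) • θ) h
    hb (by rwa [hθε]) hdiv (by simp [hn])
  have htR : ∀ i, bcSimple u i ∈ R := by
    intro i
    rw [hroots]
    unfold bcSimple
    split_ifs with h0
    · exact Or.inl ⟨i, 1, Or.inl rfl, Or.inl (one_smul _ _).symm⟩
    · refine Or.inr ⟨i, _, ?_, 1, -1, Or.inl rfl, Or.inr rfl, by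
        rw [one_smul, neg_one_smul, sub_eq_add_neg]⟩
      intro e
      have := congrArg Fin.val e
      simp only at this
      omega
  have htpos : ∀ i, 0 < height b (bcSimple u i) := by
    intro i
    unfold bcSimple
    split_ifs with h0
    · exact hpos i
    · rw [map_sub, sub_pos]
      exact hmono (Fin.lt_def.2 (by simp only; omega))
  obtain ⟨π, hπ⟩ := exists_perm_of_closure (b := b) (t := bcSimple u)
    (fun i => h.ne_zero (htR i)) (fun i => hb.mem_closure_of_height_pos (htR i) (htpos i))
    (fun i => ((hroots _).1 (hb.2.1 i)).mem_closure_bcSimple hpos hmono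
      (by rw [height_basis]; exact one_pos))
  refine ⟨u, π, hgram, hπ, ?_⟩
  have hlast : (2 : ℝ) • u (Fin.last r) ∈ R :=
    (hroots _).2 (Or.inl ⟨_, 1, Or.inl rfl, Or.inr (by rw [mul_one])⟩)
  -- Twice the last `u` is a root, hence dominated by `θ`; no root is higher than it, by the
  -- explicit list, so the difference has height at most zero.
  refine sub_eq_zero.1 (eq_zero_of_height_nonpos (hθ.2 _ hlast) ?_)
  have hle : ∀ i, height b (u i) ≤ height b (u (Fin.last r)) := fun i => hmono.monotone (Fin.le_last i)
  rw [map_sub, map_smul, smul_eq_mul]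
  have hl := hpos (Fin.last r)
  rcases (hroots θ).1 hθ.1 with ⟨i, s, hs, e | e⟩ | ⟨i, j, -, s, t, hs, ht, e⟩
  · rw [e, map_smul, smul_eq_mul]
    rcases hs with rfl | rfl <;> linarith [hle i, hpos i]
  · rw [e, map_smul, smul_eq_mul]
    rcases hs with rfl | rfl <;> linarith [hle i, hpos i]
  · rw [e, map_add, map_smul, map_smul, smul_eq_mul, smul_eq_mul]
    rcases hs with rfl | rfl <;> rcases ht with rfl | rfl <;>
      linarith [hle i, hpos i, hle j, hpos j]

end BC

/-! ### Restricted roots -/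

section RestrictedRoots

variable {𝔤 : Type*} [LieRing 𝔤] [LieAlgebra ℝ 𝔤] {𝔞 : Submodule ℝ 𝔤} {r : ℕ}

/-- The scalar product of linear forms on `𝔞` in which the dual basis of `e` is orthonormal. -/
def dilatonProduct (e : Basis (Fin r) ℝ 𝔞) : LinearMap.BilinForm ℝ (Dual ℝ 𝔞) :=
  ∑ a, (Dual.eval ℝ 𝔞 (e a)).smulRight (Dual.eval ℝ 𝔞 (e a))

theorem dilatonProduct_apply (e : Basis (Fin r) ℝ 𝔞) (l m : Dual ℝ 𝔞) :
    dilatonProduct e l m = ∑ a, l (e a) * m (e a) := by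
  simp [dilatonProduct]

theorem dilatonProduct_comm (e : Basis (Fin r) ℝ 𝔞) (l m : Dual ℝ 𝔞) :
    dilatonProduct e l m = dilatonProduct e m l := by
  simp only [dilatonProduct_apply, mul_comm]

theorem dilatonProduct_pos (e : Basis (Fin r) ℝ 𝔞) {l : Dual ℝ 𝔞} (hl : l ≠ 0) :
    0 < dilatonProduct e l l := by
  rw [dilatonProduct_apply]
  obtain ⟨a, ha⟩ : ∃ a, l (e a) ≠ 0 := by
    by_contra! hc
    exact hl (e.ext fun a => by simp [hc])
  exact Finset.sum_pos' (fun a _ => mul_self_nonneg _) ⟨a, Finset.mem_univ a, mul_self_pos.2 ha⟩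

/-- The vector of `𝔞` dual to a linear form. -/
def dilatonVector (e : Basis (Fin r) ℝ 𝔞) (l : Dual ℝ 𝔞) : 𝔞 := ∑ a, l (e a) • e a

theorem apply_dilatonVector (e : Basis (Fin r) ℝ 𝔞) (l m : Dual ℝ 𝔞) :
    m (dilatonVector e l) = dilatonProduct e l m := by
  simp [dilatonVector, dilatonProduct_apply]

/-- The basis `e` is orthonormal for `c` times the Killing form, so `dilatonVector e l` represents
`l` with respect to that form. -/
theorem killingForm_dilatonVector {e : Basis (Fin r) ℝ 𝔞} {c : ℝ}
    (hc : ∀ a b, c * killingForm ℝ 𝔤 (e a : 𝔤) (e b : 𝔤) = if a = b then 1 else 0)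
    (l : Dual ℝ 𝔞) (x : 𝔞) : c * killingForm ℝ 𝔤 (dilatonVector e l : 𝔤) (x : 𝔤) = l x := by
  let f : Dual ℝ 𝔞 := (c • killingForm ℝ 𝔤 (dilatonVector e l : 𝔤)) ∘ₗ 𝔞.subtype
  have : f = l := by
    refine e.ext fun b => ?_
    simp only [f, dilatonVector, LinearMap.comp_apply, LinearMap.smul_apply, Submodule.subtype_apply,
      Submodule.coe_sum, Submodule.coe_smul, map_sum, map_smul, LinearMap.sum_apply, smul_eq_mul,
      Finset.mul_sum]
    rw [Finset.sum_eq_single b]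
    · rw [mul_left_comm, hc, if_pos rfl, mul_one]
    · intro a _ hab
      rw [mul_left_comm, hc, if_neg hab, mul_zero]
    · simp
  exact LinearMap.congr_fun this x

/-- An element of `𝔞` is determined by its scalar products. -/
theorem eq_smul_dilatonVector {e : Basis (Fin r) ℝ 𝔞} {c : ℝ}
    (hc : ∀ a b, c * killingForm ℝ 𝔤 (e a : 𝔤) (e b : 𝔤) = if a = b then 1 else 0)
    {l : Dual ℝ 𝔞} {y : 𝔞} {d : ℝ} (hy : ∀ x : 𝔞, killingForm ℝ 𝔤 (y : 𝔤) (x : 𝔤) = d * l x) :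
    y = (c * d) • dilatonVector e l := by
  have key : ∀ z : 𝔞, (∀ x : 𝔞, c * killingForm ℝ 𝔤 (z : 𝔤) (x : 𝔤) = 0) → z = 0 := by
    intro z hz
    refine e.repr.injective (Finsupp.ext fun b => ?_)
    have h1 := hz (e b)
    rw [← e.sum_repr z] at h1
    simp only [Submodule.coe_sum, Submodule.coe_smul, map_sum, map_smul, LinearMap.sum_apply,
      LinearMap.smul_apply, smul_eq_mul, Finset.mul_sum] at h1
    rw [Finset.sum_eq_single b] at h1
    · rw [mul_left_comm, hc, if_pos rfl, mul_one] at h1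
      simpa using h1
    · intro a _ hab
      rw [mul_left_comm, hc, if_neg hab, mul_zero]
    · simp
  refine sub_eq_zero.1 (key _ fun x => ?_)
  simp only [Submodule.coe_sub, Submodule.coe_smul, map_sub, map_smul, LinearMap.sub_apply,
    LinearMap.smul_apply, smul_eq_mul, hy]
  have := killingForm_dilatonVector hc l x
  rw [mul_sub, ← this]
  ring

theorem lie_mem_restrictedRootSpace {l m : Dual ℝ 𝔞} {x y : 𝔤} (hx : x ∈ restrictedRootSpace 𝔞 l)
    (hy : y ∈ restrictedRootSpace 𝔞 m) : ⁅x, y⁆ ∈ restrictedRootSpace 𝔞 (l + m) := by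
  intro h
  rw [leibniz_lie, hx h, hy h, smul_lie, lie_smul, LinearMap.add_apply, add_smul]

theorem smul_mem_restrictedRootSpace {l : Dual ℝ 𝔞} {x : 𝔤} (hx : x ∈ restrictedRootSpace 𝔞 l)
    (c : ℝ) : c • x ∈ restrictedRootSpace 𝔞 l := by
  intro h
  rw [lie_smul, hx h, smul_comm]

/-- A nilpotent vector of an `𝔰𝔩₂`-triple inside a weight string. -/
theorem pow_toEnd_mem_restrictedRootSpace {l m : Dual ℝ 𝔞} {x y : 𝔤}
    (hx : x ∈ restrictedRootSpace 𝔞 l) (hy : y ∈ restrictedRootSpace 𝔞 m) (n : ℕ) :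
    ((LieModule.toEnd ℝ 𝔤 𝔤 x) ^ n) y ∈ restrictedRootSpace 𝔞 (m + (n : ℝ) • l) := by
  induction n with
  | zero => simpa using hy
  | succ n ih =>
    rw [pow_succ', Module.End.mul_apply, LieModule.toEnd_apply_apply]
    have := lie_mem_restrictedRootSpace hx ih
    convert! this using 2
    push_cast
    module

/-- Weights of the adjoint representation are stable under the reflection of an `𝔰𝔩₂`-triple made of
restricted root vectors. -/
theorem IsSl2Triple.exists_reflect [FiniteDimensional ℝ 𝔤] {l m : Dual ℝ 𝔞} {h : 𝔞} {x y z : 𝔤}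
    (t : IsSl2Triple (h : 𝔤) x y) (hx : x ∈ restrictedRootSpace 𝔞 l)
    (hy : y ∈ restrictedRootSpace 𝔞 (-l)) (hz : z ∈ restrictedRootSpace 𝔞 m) (hz0 : z ≠ 0) :
    ∃ k : ℤ, m h = k ∧ ∃ w ∈ restrictedRootSpace 𝔞 (m - (k : ℝ) • l), w ≠ 0 := by
  have main : ∀ {l : Dual ℝ 𝔞} {h : 𝔞} {x y : 𝔤}, IsSl2Triple (h : 𝔤) x y →
      x ∈ restrictedRootSpace 𝔞 l → y ∈ restrictedRootSpace 𝔞 (-l) → 0 ≤ m h →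
      ∃ k : ℤ, m h = k ∧ ∃ w ∈ restrictedRootSpace 𝔞 (m - (k : ℝ) • l), w ≠ 0 := by
    intro l h x y t hx hy hm
    have hl : l h = 2 := by
      have h1 := hx h
      rw [t.lie_h_e_smul ℝ] at h1
      exact (smul_left_injective ℝ t.e_ne_zero h1).symm
    -- The powers of `ad x` on `z` have pairwise distinct `ad h`-eigenvalues, so in finite dimension
    -- they cannot all be nonzero.
    have hex : ∃ n : ℕ, ((LieModule.toEnd ℝ 𝔤 𝔤 x) ^ n) z = 0 := by
      by_contra! hc
      have hs : (Set.range fun n : ℕ => m h + 2 * (n : ℝ)).Infinite := by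
        rw [Set.infinite_range_iff (fun n m => by simp)]
        infer_instance
      have heig : ∀ n : ℕ, ⁅(h : 𝔤), ((LieModule.toEnd ℝ 𝔤 𝔤 x) ^ n) z⁆
          = (m h + 2 * (n : ℝ)) • ((LieModule.toEnd ℝ 𝔤 𝔤 x) ^ n) z :=
        fun n => t.lie_h_pow_toEnd_e (hz h) n
      exact hs ((LieModule.toEnd ℝ 𝔤 𝔤 (h : 𝔤)).eigenvectors_linearIndependent
        (Set.range fun n : ℕ => m h + 2 * (n : ℝ))
        (fun ⟨s, hs⟩ => ((LieModule.toEnd ℝ 𝔤 𝔤 x) ^ (Classical.choose hs)) z)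
        (fun ⟨s, hs⟩ => by
          have h1 := heig (Classical.choose hs)
          rw [show m h + 2 * ((Classical.choose hs : ℕ) : ℝ) = s from Classical.choose_spec hs] at h1
          exact Module.End.hasEigenvector_iff.2
            ⟨Module.End.mem_eigenspace_iff.2 h1, hc _⟩)).finite
    obtain ⟨p, hp0, hp1⟩ := Nat.exists_not_and_succ_of_not_zero_of_exists
      (p := fun n => ((LieModule.toEnd ℝ 𝔤 𝔤 x) ^ n) z = 0) (by simpa using hz0) hex
    -- The last nonzero power is a primitive vector, of weight `n = m h + 2p`. Lowering it `n - p`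
    -- times leads to the weight `m + p l - (n - p) l = m - (m h) l`. The result is nonzero because
    -- `n - p ≤ n`; `m h ≥ 0` gives `2p ≤ n`.
    set u := ((LieModule.toEnd ℝ 𝔤 𝔤 x) ^ p) z with hu
    have P : t.HasPrimitiveVectorWith u (m h + 2 * (p : ℝ)) :=
      { ne_zero := hp0
        lie_h := t.lie_h_pow_toEnd_e (hz h) p
        lie_e := by rw [hu, IsSl2Triple.lie_e_pow_toEnd_e]; exact hp1 }
    obtain ⟨n, hn⟩ := P.exists_nat
    have hle : 2 * p ≤ n := by
      have : (2 * p : ℝ) ≤ n := by linarith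
      exact_mod_cast this
    have hmk : m h = ((n - 2 * p : ℕ) : ℤ) := by
      rw [Int.cast_natCast, Nat.cast_sub hle, ← hn]
      push_cast
      ring
    refine ⟨((n - 2 * p : ℕ) : ℤ), hmk, ((LieModule.toEnd ℝ 𝔤 𝔤 y) ^ (n - p)) u, ?_,
      P.pow_toEnd_f_ne_zero_of_eq_nat hn (Nat.sub_le _ _)⟩
    have h1 := pow_toEnd_mem_restrictedRootSpace hy
      (pow_toEnd_mem_restrictedRootSpace hx hz p) (n - p)
    convert! h1 using 2
    have hpn : p ≤ n := by omega
    rw [Int.cast_natCast, Nat.cast_sub hle, Nat.cast_sub hpn]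
    push_cast
    module
  rcases le_total 0 (m h) with hm | hm
  · exact main t hx hy hm
  -- For negative `m h`, exchange `x` and `y`, which replaces `h` and `l` by their negatives.
  · have t' : IsSl2Triple (((-h : 𝔞) : 𝔤)) y x := by
      rw [Submodule.coe_neg]; exact t.symm
    obtain ⟨k, hk, w, hw, hw0⟩ := main t' hy (by rwa [neg_neg]) (by simpa using hm)
    refine ⟨-k, ?_, w, ?_, hw0⟩
    · rw [map_neg] at hk
      push_cast
      linarith
    · convert! hw using 2
      push_cast
      module

/-- Restricted root vectors belong to `𝔰𝔩₂`-triples. -/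
theorem exists_isSl2Triple {τ : 𝔤 ≃ₗ⁅ℝ⁆ 𝔤} (hτ : IsCartanInvolution τ)
    (h𝔞 : IsMaximalAbelianNoncompact τ 𝔞) {e : Basis (Fin r) ℝ 𝔞} {c : ℝ}
    (hc : ∀ a b, c * killingForm ℝ 𝔤 (e a : 𝔤) (e b : 𝔤) = if a = b then 1 else 0)
    {l : Dual ℝ 𝔞} (hl : l ∈ restrictedRoots 𝔞) :
    ∃ x ∈ restrictedRootSpace 𝔞 l, ∃ y ∈ restrictedRootSpace 𝔞 (-l),
      IsSl2Triple (((2 / dilatonProduct e l l) • dilatonVector e l : 𝔞) : 𝔤) x y := by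
  obtain ⟨hl0, x, hx, hx0⟩ := hl
  have hll := dilatonProduct_pos e hl0
  have hτx : τ x ∈ restrictedRootSpace 𝔞 (-l) := by
    intro h
    have h1 : τ ⁅τ (h : 𝔤), x⁆ = ⁅(h : 𝔤), τ x⁆ := by
      rw [LieEquiv.map_lie, hτ.1]
    rw [← h1, h𝔞.1 _ h.2, neg_lie, hx h, map_neg, map_smul, LinearMap.neg_apply, neg_smul]
  -- The bracket is anti-invariant under `τ` and has weight zero, so it commutes with `𝔞` and lies
  -- in `𝔞` by maximality.
  have hmem : ⁅x, τ x⁆ ∈ 𝔞 := by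
    refine h𝔞.2.2 _ ?_ fun y hy => ?_
    · rw [LieEquiv.map_lie, hτ.1, ← lie_skew]
    · have h1 := lie_mem_restrictedRootSpace hx hτx ⟨y, hy⟩
      rw [add_neg_cancel, LinearMap.zero_apply, zero_smul] at h1
      rw [← lie_skew]
      exact neg_eq_zero.2 h1
  set d := killingForm ℝ 𝔤 x (τ x) with hd
  have hd0 : d ≠ 0 := by
    have := hτ.2 x hx0
    linarith
  -- By invariance `κ(⁅x, τ x⁆, h) = κ(x, τ x) l(h)`, so the bracket is proportional to the dual
  -- vector of `l`. The factor is nonzero, since `κ(x, τ x) < 0`; rescaling `τ x` completes the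
  -- triple.
  have hxy : ⁅x, τ x⁆ = ((c * d) • dilatonVector e l : 𝔞) := by
    have := eq_smul_dilatonVector hc (l := l) (y := ⟨_, hmem⟩) (d := d) fun h => by
      rw [LieModule.traceForm_apply_lie_apply, ← lie_skew, hτx h, map_neg, map_smul]
      simp [hd, mul_comm]
    exact congrArg Subtype.val this
  have hc0 : c ≠ 0 := by
    rintro rfl
    have hr : Nonempty (Fin r) := by
      by_contra hne
      rw [not_nonempty_iff] at hne
      rw [dilatonProduct_apply] at hll
      simp at hll
    obtain ⟨a⟩ := hr
    simpa using hc a a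
  set q : ℝ := 2 / dilatonProduct e l l with hq
  have hq0 : q ≠ 0 := (div_pos two_pos hll).ne'
  have hlh : l (q • dilatonVector e l) = 2 := by
    rw [map_smul, apply_dilatonVector, smul_eq_mul, hq, div_mul_cancel₀ _ hll.ne']
  refine ⟨x, hx, (q / (c * d)) • τ x, smul_mem_restrictedRootSpace hτx _, ?_⟩
  refine ⟨?_, ?_, ?_, ?_⟩
  · intro h0
    have : q • dilatonVector e l = 0 := Subtype.ext h0
    rw [this, map_zero] at hlh
    norm_num at hlh
  · rw [lie_smul, hxy, Submodule.coe_smul, smul_smul, Submodule.coe_smul,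
      div_mul_cancel₀ _ (mul_ne_zero hc0 hd0)]
  · rw [hx, hlh, ofNat_smul_eq_nsmul]
  · rw [lie_smul, hτx, LinearMap.neg_apply, hlh, ← ofNat_smul_eq_nsmul ℝ]
    module

/-- Restricted roots form a (possibly nonreduced) root system. -/
theorem isRootSet_restrictedRoots [FiniteDimensional ℝ 𝔤] {τ : 𝔤 ≃ₗ⁅ℝ⁆ 𝔤}
    (hτ : IsCartanInvolution τ) (h𝔞 : IsMaximalAbelianNoncompact τ 𝔞) {e : Basis (Fin r) ℝ 𝔞}
    {c : ℝ} (hc : ∀ a b, c * killingForm ℝ 𝔤 (e a : 𝔤) (e b : 𝔤) = if a = b then 1 else 0) :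
    IsRootSet (dilatonProduct e) (restrictedRoots 𝔞) where
  symm := dilatonProduct_comm e
  pos _ := dilatonProduct_pos e
  zero_notMem h := h.1 rfl
  reflect l hl m hm := by
    obtain ⟨x, hx, y, hy, t⟩ := exists_isSl2Triple hτ h𝔞 hc hl
    obtain ⟨hm0, z, hz, hz0⟩ := hm
    obtain ⟨k, hk, w, hw, hw0⟩ := t.exists_reflect hx hy hz hz0
    have hll := dilatonProduct_pos e hl.1
    rw [map_smul, apply_dilatonVector, smul_eq_mul] at hk
    have hk' : 2 * dilatonProduct e l m = k * dilatonProduct e l l := by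
      rw [← hk]
      field_simp
    refine ⟨k, hk', ?_, w, hw, hw0⟩
    -- If `m = k l`, then the definition of `k` gives `2k = k`, so `m = 0`.
    intro h0
    rw [sub_eq_zero] at h0
    rw [h0, map_smul, smul_eq_mul] at hk'
    have hk0 : (k : ℝ) = 0 := by
      have : (k : ℝ) * dilatonProduct e l l = 0 := by linarith
      exact (mul_eq_zero.1 this).resolve_right hll.ne'
    rw [hk0, zero_smul] at h0
    exact hm0 h0

end RestrictedRoots

section Walls

variable {𝔤 : Type*} [LieRing 𝔤] [LieAlgebra ℝ 𝔤] {𝔞 : Submodule ℝ 𝔤} {r : ℕ}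

/-! ### Scalar products of walls -/

theorem formProduct_electric_electric (e : Basis (Fin r) ℝ 𝔞) (l m : Dual ℝ 𝔞) :
    formProduct e (electricWall l) (electricWall m) = dilatonProduct e l m := by
  simp [formProduct, dBeta, dPhi, electricWall, dilatonForm, dilatonProduct_apply]

theorem formProduct_electric_magnetic (e : Basis (Fin r) ℝ 𝔞) (i : Fin 2) (l m : Dual ℝ 𝔞) :
    formProduct e (electricWall l) (magneticWall i m) = -dilatonProduct e l m := by
  simp [formProduct, dBeta, dPhi, electricWall, magneticWall, dilatonForm, betaForm,
    dilatonProduct_apply]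

/-- The form `β¹` is null: its contribution is `1 - 1² = 0`. -/
theorem formProduct_magnetic_magnetic (e : Basis (Fin r) ℝ 𝔞) (l m : Dual ℝ 𝔞) :
    formProduct e (magneticWall 0 l) (magneticWall 0 m) = dilatonProduct e l m := by
  simp [formProduct, dBeta, dPhi, magneticWall, dilatonForm, betaForm, dilatonProduct_apply]

theorem formProduct_electric_symmetry (e : Basis (Fin r) ℝ 𝔞) (l : Dual ℝ 𝔞) :
    formProduct e (electricWall l) (symmetryWall 𝔞) = 0 := by
  simp [formProduct, dBeta, dPhi, electricWall, symmetryWall, dilatonForm, betaForm]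

theorem formProduct_magnetic_symmetry (e : Basis (Fin r) ℝ 𝔞) (l : Dual ℝ 𝔞) :
    formProduct e (magneticWall 0 l) (symmetryWall 𝔞) = -1 := by
  simp [formProduct, dBeta, dPhi, magneticWall, symmetryWall, dilatonForm, betaForm]

theorem formProduct_symmetry_symmetry (e : Basis (Fin r) ℝ 𝔞) :
    formProduct e (symmetryWall 𝔞) (symmetryWall 𝔞) = 2 := by
  simp [formProduct, dBeta, dPhi, symmetryWall, betaForm]
  norm_num

theorem linearIndependent_dominantWall (b : Basis (Fin r) ℝ (Dual ℝ 𝔞)) (θ : Dual ℝ 𝔞) :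
    LinearIndependent ℝ (dominantWall b θ) := by
  rw [Fintype.linearIndependent_iff]
  intro a ha
  simp only [Fintype.sum_option, dominantWall] at ha
  have h1 := LinearMap.congr_fun ha (Pi.single 1 1, 0)
  have h2 := LinearMap.congr_fun ha (Pi.single 0 1, 0)
  simp [electricWall, magneticWall, symmetryWall, dilatonForm, betaForm] at h1 h2
  rw [h1, neg_zero, zero_add] at h2
  have h3 : ∑ i, a (some (some i)) • b i = 0 := by
    refine LinearMap.ext fun x => ?_
    have := LinearMap.congr_fun ha (0, x)
    rw [h1, h2] at this
    simpa [electricWall, dilatonForm] using this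
  rintro (_ | _ | i)
  · exact h1
  · exact h2
  · exact Fintype.linearIndependent_iff.1 b.linearIndependent _ h3 i

variable {R : Set (Dual ℝ 𝔞)} {e : Basis (Fin r) ℝ 𝔞} {b : Basis (Fin r) ℝ (Dual ℝ 𝔞)}
  {θ : Dual ℝ 𝔞}

/-- Common to both cases: the signs of the scalar products come from dominance of `θ` and from the
simple system, so only the Cartan integers remain to be identified. -/
theorem isWeylChamberOf_dominantWall (h : IsRootSet (dilatonProduct e) R)
    (hb : IsSimpleSystem R b) (hθ : IsHighestRoot R b θ) (hn : dilatonProduct e θ θ = 2)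
    {J : Type*} [instJ : DecidableEq J] {A : Matrix J J ℤ} (ν : Option (Option (Fin r)) ≃ J)
    (hA : ∀ i j, (A (ν i) (ν j) : ℝ) = 2 * formProduct e (dominantWall b θ i) (dominantWall b θ j) /
      formProduct e (dominantWall b θ i) (dominantWall b θ i)) :
    IsWeylChamberOf e {x | ∀ i, 0 ≤ dominantWall b θ i x} (dominantWall b θ) A := by
  have hnonneg := hθ.form_nonneg hb h
  refine isWeylChamberOf_of_formProduct e (linearIndependent_dominantWall b θ) (by simp) ?_ ?_ ν hA
  · rintro (_ | _ | i)
    · simp [dominantWall, formProduct_symmetry_symmetry]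
    · simp [dominantWall, formProduct_magnetic_magnetic, hn]
    · simpa [dominantWall, formProduct_electric_electric] using h.pos _ (b.ne_zero i)
  · rintro (_ | _ | i) (_ | _ | j) hij
    · exact absurd rfl hij
    · rw [formProduct_comm]
      simp [dominantWall, formProduct_magnetic_symmetry]
    · rw [formProduct_comm]
      simp [dominantWall, formProduct_electric_symmetry]
    · simp [dominantWall, formProduct_magnetic_symmetry]
    · exact absurd rfl hij
    · rw [formProduct_comm]
      simpa [dominantWall, formProduct_electric_magnetic] using hnonneg j
    · simp [dominantWall, formProduct_electric_symmetry]
    · simpa [dominantWall, formProduct_electric_magnetic] using hnonneg i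
    · simp only [dominantWall, formProduct_electric_electric]
      exact hb.form_nonpos h fun e => hij (by rw [e])

theorem billiard_eq_dominantWall (h : IsRootSet (dilatonProduct e) (restrictedRoots 𝔞))
    (hb : IsSimpleSystem (restrictedRoots 𝔞) b) (hθ : IsHighestRoot (restrictedRoots 𝔞) b θ) :
    billiard b = {x | ∀ i, 0 ≤ dominantWall b θ i x} := by
  ext x
  constructor
  · rintro ⟨h1, h2, h3⟩ (_ | _ | i)
    · exact h3
    · exact h2 0 θ ⟨hθ.1, hθ.mem_closure hb h⟩
    · exact h1 _ ⟨hb.2.1 i, AddSubmonoid.subset_closure ⟨i, rfl⟩⟩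
  · intro hx
    have hcl : ∀ l ∈ AddSubmonoid.closure (Set.range b), 0 ≤ l x.2 := by
      intro l hl
      induction hl using AddSubmonoid.closure_induction with
      | mem l hl =>
        obtain ⟨i, rfl⟩ := hl
        exact hx (some (some i))
      | zero => simp
      | add l m _ _ hl hm => simpa using add_nonneg hl hm
    have hs : 0 ≤ x.1 1 - x.1 0 := hx none
    have hm : 0 ≤ x.1 0 - θ x.2 := hx (some none)
    refine ⟨fun l hl => hcl l hl.2, fun i l hl => ?_, hs⟩
    have h1 : 0 ≤ θ x.2 - l x.2 := hcl _ (hθ.2 l hl.1)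
    change 0 ≤ x.1 i - l x.2
    fin_cases i
    · simp only [Fin.zero_eta]
      linarith
    · simp only [Fin.mk_one]
      linarith

/-! ### Restricted root systems of type `bc` -/

theorem form_bcSimple {V : Type*} [AddCommGroup V] [Module ℝ V] {B : LinearMap.BilinForm ℝ V}
    {u : Fin r → V} (hu : ∀ i j, B (u i) (u j) = if i = j then 1 / 2 else 0) (i j : Fin r) :
    B (bcSimple u i) (bcSimple u j) =
      if i = j then (if (i : ℕ) = 0 then 1 / 2 else 1)
      else if (i : ℕ) + 1 = j ∨ (j : ℕ) + 1 = i then -1 / 2 else 0 := by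
  obtain ⟨i, hi⟩ := i
  obtain ⟨j, hj⟩ := j
  unfold bcSimple
  simp only [Fin.mk.injEq]
  by_cases h1 : i = 0 <;> by_cases h2 : j = 0 <;>
    simp only [h1, h2, if_true, if_false, map_sub, LinearMap.sub_apply, hu, Fin.mk.injEq] <;>
    split_ifs <;> first | omega | grind

theorem form_bcSimple_last {V : Type*} [AddCommGroup V] [Module ℝ V]
    {B : LinearMap.BilinForm ℝ V} {u : Fin (r + 1) → V}
    (hu : ∀ i j, B (u i) (u j) = if i = j then 1 / 2 else 0) (i : Fin (r + 1)) :
    B (bcSimple u i) (u (Fin.last r)) = if (i : ℕ) = r then 1 / 2 else 0 := by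
  obtain ⟨i, hi⟩ := i
  unfold bcSimple
  simp only [Fin.last]
  by_cases h1 : i = 0
  · simp only [h1, if_true, hu, Fin.mk.injEq]
  · simp only [h1, if_false, map_sub, LinearMap.sub_apply, hu, Fin.mk.injEq]
    split_ifs <;> first | omega | norm_num

theorem isWeylChamberOf_of_isOfBCType (h : IsRootSet (dilatonProduct e) R)
    (hb : IsSimpleSystem R b) (hθ : IsHighestRoot R b θ) (hn : dilatonProduct e θ θ = 2) {n : ℕ}
    (hR : IsOfBCType R n) :
    IsWeylChamberOf e {x | ∀ i, 0 ≤ dominantWall b θ i x} (dominantWall b θ)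
      (KacMoody.lorentzianExtension (twistedA2Even n) (Fin.last n)) := by
  -- Both numbers are the dimension of the dual of `𝔞`.
  obtain rfl : n = r := by
    obtain ⟨f, -⟩ := hR
    have h1 := f.finrank_eq
    rw [finrank_eq_card_basis b] at h1
    simpa using h1.symm
  have hdiv := hθ.half_mem_of_isOfBCType hR h.zero_notMem
  obtain ⟨m, rfl⟩ := Nat.exists_eq_succ_of_ne_zero (hθ.rank_pos h).ne'
  obtain ⟨u, π, hu, hπ, hθu⟩ := IsHighestRoot.exists_bcSimple h hb hθ hdiv hn
  -- The short simple root goes to node `0` and `β¹ - θ` to the last node, the longest. Among the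
  -- simple roots only `u_m - u_{m-1}` (or `u_0`, if `m = 0`) has nonzero product with `θ`. Its norm
  -- is `1` (or `1/2`), which gives the entry `-2` (or `-4`).
  obtain ⟨ν, hν0, hν1, hν2⟩ : ∃ ν : Option (Option (Fin (m + 1))) ≃ Option (Fin (m + 1 + 1)),
      ν none = none ∧ ν (some none) = some (Fin.last (m + 1)) ∧
        ∀ i, ν (some (some i)) = some (π i).castSucc :=
    ⟨Equiv.optionCongr ((Equiv.optionCongr π).trans finSuccEquivLast.symm), rfl,
      congrArg some finSuccEquivLast_symm_none, fun i => congrArg some (finSuccEquivLast_symm_some _)⟩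
  refine isWeylChamberOf_dominantWall h hb hθ hn ν ?_
  have h1 := form_bcSimple hu
  have h2 : ∀ i, dilatonProduct e (bcSimple u i) θ = if (i : ℕ) = m then 1 else 0 := by
    intro i
    rw [hθu, map_smul, form_bcSimple_last hu]
    split_ifs <;> norm_num
  have hne : ∀ p : Fin (m + 1), p.castSucc ≠ Fin.last (m + 1) := fun p => (Fin.castSucc_lt_last p).ne
  rintro (_ | _ | i) (_ | _ | j) <;> simp only [hν0, hν1, hν2]
  · simp [KacMoody.lorentzianExtension, dominantWall, formProduct_symmetry_symmetry]
  · rw [formProduct_comm]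
    simp [KacMoody.lorentzianExtension, dominantWall, formProduct_symmetry_symmetry,
      formProduct_magnetic_symmetry]
  · rw [formProduct_comm]
    simp [KacMoody.lorentzianExtension, dominantWall, formProduct_electric_symmetry, hne]
  · simp [KacMoody.lorentzianExtension, dominantWall, formProduct_magnetic_magnetic,
      formProduct_magnetic_symmetry, hn]
  · simp [KacMoody.lorentzianExtension, dominantWall, formProduct_magnetic_magnetic, hn,
      twistedA2Even]
  · rw [formProduct_comm]
    simp only [dominantWall, formProduct_electric_magnetic, formProduct_magnetic_magnetic, hn, hπ,
      h2, KacMoody.lorentzianExtension, twistedA2Even, (hne _).symm, if_false, Fin.val_last,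
      Fin.val_castSucc]
    generalize π j = p
    obtain ⟨p, hp⟩ := p
    simp only
    split_ifs <;> first | omega | norm_num
  · simp [KacMoody.lorentzianExtension, dominantWall, formProduct_electric_symmetry, hne]
  · simp only [dominantWall, formProduct_electric_magnetic, formProduct_electric_electric, hπ,
      h2, h1, KacMoody.lorentzianExtension, twistedA2Even, hne, if_false, if_true, Fin.val_last,
      Fin.val_castSucc]
    generalize π i = p
    obtain ⟨p, hp⟩ := p
    simp only
    split_ifs <;> first | omega | norm_num
  · simp only [dominantWall, formProduct_electric_electric, hπ, h1, KacMoody.lorentzianExtension,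
      twistedA2Even, Fin.castSucc_inj, Fin.val_castSucc]
    generalize π i = p
    generalize π j = q
    obtain ⟨p, hp⟩ := p
    obtain ⟨q, hq⟩ := q
    simp only [Fin.mk.injEq]
    split_ifs <;> first | omega | norm_num

end Walls

/-! ### Roots and coroots of the maximal split subalgebra. -/

section MaximalSplit

open LieAlgebra.IsKilling

variable {𝔤 : Type*} [LieRing 𝔤] [LieAlgebra ℝ 𝔤] {𝔞 : Submodule ℝ 𝔤} {r : ℕ}
  {F : LieSubalgebra ℝ 𝔤} {T : LieSubalgebra ℝ F}

/-- The identification of the Cartan subalgebra of a maximal split subalgebra with `𝔞`. -/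
theorem IsMaximalSplitSubalgebra.exists_equiv (hF : IsMaximalSplitSubalgebra 𝔞 F T) :
    ∃ φ : T ≃ₗ[ℝ] 𝔞, ∀ t : T, ((φ t : 𝔞) : 𝔤) = ((t : F) : 𝔤) := by
  let f : T →ₗ[ℝ] 𝔞 :=
    { toFun := fun t => ⟨((t : F) : 𝔤), (hF.1 _).2 ⟨t, t.2, rfl⟩⟩
      map_add' := fun _ _ => rfl
      map_smul' := fun _ _ => rfl }
  refine ⟨LinearEquiv.ofBijective f ⟨fun s t h => ?_, fun x => ?_⟩, fun t => rfl⟩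
  · exact Subtype.ext (Subtype.ext (congrArg (fun x : 𝔞 => (x : 𝔤)) h))
  · obtain ⟨t, ht, hx⟩ := (hF.1 _).1 x.2
    exact ⟨⟨t, ht⟩, Subtype.ext hx⟩

variable [FiniteDimensional ℝ 𝔤] [LieAlgebra.IsKilling ℝ F] [T.IsCartanSubalgebra]
  [LieModule.IsTriangularizable ℝ T F]

theorem IsMaximalSplitSubalgebra.root_mem (hF : IsMaximalSplitSubalgebra 𝔞 F T)
    {φ : T ≃ₗ[ℝ] 𝔞} (hφ : ∀ t : T, ((φ t : 𝔞) : 𝔤) = ((t : F) : 𝔤)) (α : T.root) :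
    φ.symm.dualMap ((rootSystem T).root α) ∈ restrictedRoots 𝔞 := by
  refine ((hF.2 _).1 ⟨?_, ?_⟩).1
  · rw [Ne, LinearEquiv.map_eq_zero_iff]
    exact (rootSystem T).ne_zero α
  · obtain ⟨x, hx0, hx⟩ := LieModule.exists_forall_lie_eq_smul ℝ T F α.1
    refine ⟨x, x.2, fun h => ?_, fun h0 => hx0 (Subtype.ext h0)⟩
    have h1 := congrArg Subtype.val (hx (φ.symm h))
    have h2 : ((φ.symm h : F) : 𝔤) = h := by rw [← hφ, φ.apply_symm_apply]
    rw [← h2]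
    exact h1

theorem IsMaximalSplitSubalgebra.exists_root (hF : IsMaximalSplitSubalgebra 𝔞 F T)
    {φ : T ≃ₗ[ℝ] 𝔞} (hφ : ∀ t : T, ((φ t : 𝔞) : 𝔤) = ((t : F) : 𝔤)) {l : Dual ℝ 𝔞}
    (hl : l ∈ restrictedRoots 𝔞) (hl2 : (1 / 2 : ℝ) • l ∉ restrictedRoots 𝔞) :
    ∃ α : T.root, (rootSystem T).root α = φ.dualMap l := by
  obtain ⟨hl0, x, hxF, hx, hx0⟩ := (hF.2 l).2 ⟨hl, hl2⟩
  let y : F := ⟨x, hxF⟩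
  have hy : y ∈ LieModule.weightSpace F (fun t : T => l (φ t)) := by
    rw [LieModule.mem_weightSpace]
    intro t
    refine Subtype.ext ?_
    have := hx (φ t)
    rw [hφ] at this
    exact this
  let χ : LieModule.Weight ℝ T F :=
    { toFun := fun t : T => l (φ t)
      genWeightSpace_ne_bot' := fun h => hx0 (by
        have h1 := LieModule.weightSpace_le_genWeightSpace F _ hy
        rw [h, LieSubmodule.mem_bot] at h1
        exact congrArg Subtype.val h1) }
  have hχ : χ ∈ T.root := by
    simp only [LieSubalgebra.root, Finset.mem_filter, Finset.mem_univ, true_and]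
    intro h
    refine hl0 (LinearMap.ext fun h' => ?_)
    have := congrFun h (φ.symm h')
    simpa [χ] using! this
  refine ⟨⟨χ, hχ⟩, ?_⟩
  ext t
  rfl

/-- The coroot is `⁅x, y⁆` for an `𝔰𝔩₂`-triple in `F`. Invariance of the Killing form of `𝔤` makes
it a multiple of the dual vector of `l`, and `α(α^∨) = 2` fixes the multiple. The Killing forms of
`F` and `𝔤` need not be compared. -/
theorem IsMaximalSplitSubalgebra.coroot_eq {φ : T ≃ₗ[ℝ] 𝔞}
    (hφ : ∀ t : T, ((φ t : 𝔞) : 𝔤) = ((t : F) : 𝔤)) {e : Basis (Fin r) ℝ 𝔞} {c : ℝ}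
    (hc : ∀ a b, c * killingForm ℝ 𝔤 (e a : 𝔤) (e b : 𝔤) = if a = b then 1 else 0)
    (α : T.root) {l : Dual ℝ 𝔞} (hl : (rootSystem T).root α = φ.dualMap l) :
    φ ((rootSystem T).coroot α) = (2 / dilatonProduct e l l) • dilatonVector e l := by
  have hα : α.1.IsNonZero := by
    have := α.2
    simpa only [LieSubalgebra.root, Finset.mem_filter, Finset.mem_univ, true_and] using this
  have hαl : ∀ t : T, α.1 t = l (φ t) := fun t => LinearMap.congr_fun hl t
  obtain ⟨h, x, y, ht, hx, hy⟩ := exists_isSl2Triple_of_weight_isNonZero hα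
  have hh := ht.h_eq_coroot hα hx hy
  have hval : ((φ ((rootSystem T).coroot α) : 𝔞) : 𝔤) = ⁅(x : 𝔤), (y : 𝔤)⁆ := by
    rw [hφ, rootSystem_coroot_apply, ← hh, ← ht.lie_e_f]
    rfl
  have hyl : ∀ a : 𝔞, ⁅(a : 𝔤), (y : 𝔤)⁆ = -(l a • (y : 𝔤)) := by
    intro a
    have h1 := congrArg Subtype.val (lie_eq_smul_of_mem_rootSpace hy (φ.symm a))
    have h2 : ((φ.symm a : F) : 𝔤) = a := by rw [← hφ, φ.apply_symm_apply]
    rw [← h2]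
    refine h1.trans ?_
    rw [Pi.neg_apply, hαl, φ.apply_symm_apply, neg_smul]
    rfl
  have key := eq_smul_dilatonVector hc (l := l) (y := φ ((rootSystem T).coroot α))
    (d := killingForm ℝ 𝔤 (x : 𝔤) (y : 𝔤)) fun a => by
      rw [hval, LieModule.traceForm_apply_lie_apply, ← lie_skew, hyl, neg_neg, map_smul,
        smul_eq_mul, mul_comm]
  have h2 : l (φ ((rootSystem T).coroot α)) = 2 := by
    rw [← hαl]
    exact root_apply_coroot hα
  rw [key, map_smul, apply_dilatonVector, smul_eq_mul] at h2
  rw [key]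
  congr 1
  refine eq_div_of_mul_eq ?_ h2
  intro h0
  rw [h0, mul_zero] at h2
  norm_num at h2

/-- The pairing between roots and coroots of a maximal split subalgebra, in terms of the scalar
product of the dilatons. -/
theorem IsMaximalSplitSubalgebra.pairing_eq {φ : T ≃ₗ[ℝ] 𝔞}
    (hφ : ∀ t : T, ((φ t : 𝔞) : 𝔤) = ((t : F) : 𝔤)) {e : Basis (Fin r) ℝ 𝔞} {c : ℝ}
    (hc : ∀ a b, c * killingForm ℝ 𝔤 (e a : 𝔤) (e b : 𝔤) = if a = b then 1 else 0)
    {α β : T.root} {l m : Dual ℝ 𝔞} (hl : (rootSystem T).root α = φ.dualMap l)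
    (hm : (rootSystem T).root β = φ.dualMap m) :
    ((rootSystem T).pairingIn ℤ β α : ℝ) = 2 * dilatonProduct e l m / dilatonProduct e l l := by
  have h1 : ((rootSystem T).pairingIn ℤ β α : ℝ) = (rootSystem T).pairing β α :=
    (rootSystem T).algebraMap_pairingIn ℤ β α
  have h2 : (rootSystem T).pairing β α = m (φ ((rootSystem T).coroot α)) :=
    LinearMap.congr_fun hm ((rootSystem T).coroot α)
  rw [h1, h2, IsMaximalSplitSubalgebra.coroot_eq hφ hc α hl, map_smul, apply_dilatonVector,
    smul_eq_mul]
  ring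

/-- Simple roots are always indivisible, and `θ` is so by `hdiv`. Hence they are roots of `F` and
form a base of its root system, with `θ` as highest root there too. -/
theorem IsMaximalSplitSubalgebra.isWeylChamberOfOverextension
    (hF : IsMaximalSplitSubalgebra 𝔞 F T) {e : Basis (Fin r) ℝ 𝔞} {c : ℝ}
    (hc : ∀ a b, c * killingForm ℝ 𝔤 (e a : 𝔤) (e b : 𝔤) = if a = b then 1 else 0)
    (h : IsRootSet (dilatonProduct e) (restrictedRoots 𝔞)) {σ : Basis (Fin r) ℝ (Dual ℝ 𝔞)}
    (hσ : IsSimpleSystem (restrictedRoots 𝔞) σ) {θ : Dual ℝ 𝔞}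
    (hθ : IsHighestRoot (restrictedRoots 𝔞) σ θ) (hn : dilatonProduct e θ θ = 2)
    (hdiv : (1 / 2 : ℝ) • θ ∉ restrictedRoots 𝔞) :
    IsWeylChamberOfOverextension e {x | ∀ i, 0 ≤ dominantWall σ θ i x} (dominantWall σ θ)
      (rootSystem T) := by
  obtain ⟨φ, hφ⟩ := hF.exists_equiv
  choose idx hidx using fun i => hF.exists_root hφ (hσ.2.1 i) (hσ.half_notMem i)
  obtain ⟨η, hη⟩ := hF.exists_root hφ hθ.1 hdiv
  have hinj : Function.Injective idx := by
    intro i j hij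
    refine σ.injective (φ.dualMap.injective ?_)
    rw [← hidx, ← hidx, hij]
  have hcl : ∀ l ∈ AddSubmonoid.closure (Set.range σ), φ.dualMap l ∈
      AddSubmonoid.closure ((rootSystem T).root '' Set.range idx) := by
    intro l hl
    induction hl using AddSubmonoid.closure_induction with
    | mem l hl =>
      obtain ⟨i, rfl⟩ := hl
      rw [← hidx]
      exact AddSubmonoid.subset_closure ⟨idx i, ⟨i, rfl⟩, rfl⟩
    | zero => rw [map_zero]; exact zero_mem _
    | add l m _ _ hl hm => rw [map_add]; exact add_mem hl hm
  have hroot : ∀ α : T.root, φ.dualMap (φ.symm.dualMap ((rootSystem T).root α))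
      = (rootSystem T).root α := by
    intro α
    ext t
    simp
  obtain ⟨b, hsupp⟩ : ∃ b : (rootSystem T).Base, ∀ α, α ∈ b.support ↔ α ∈ Set.range idx := by
    refine ⟨RootPairing.Base.mk' (rootSystem T) (Set.range idx) ?_ ?_, fun α => by
      simp [RootPairing.Base.mk']⟩
    · rw [linearIndepOn_range_iff hinj]
      have : (rootSystem T).root ∘ idx = fun i => φ.dualMap (σ i) := funext hidx
      rw [this]
      exact σ.linearIndependent.map' φ.dualMap.toLinearMap φ.dualMap.ker
    · intro α
      have := hF.root_mem hφ α
      rw [← hroot α]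
      rcases hσ.2.2 _ this with h1 | h1
      · exact Or.inl (hcl _ h1)
      · exact Or.inr (by rw [← map_neg]; exact hcl _ h1)
  obtain ⟨ν₀, hν₀⟩ : ∃ ν₀ : Fin r ≃ b.support,
      ∀ i, ((ν₀ i : b.support) : T.root) = idx i := ⟨Equiv.ofBijective
    (fun i => ⟨idx i, (hsupp _).2 ⟨i, rfl⟩⟩)
    ⟨fun i j hij => hinj (congrArg Subtype.val hij), fun ⟨α, hα⟩ => by
      obtain ⟨i, rfl⟩ := (hsupp α).1 hα
      exact ⟨i, rfl⟩⟩, fun i => rfl⟩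
  have hhigh : b.IsHighestRoot η := by
    intro α
    have hb : (b.support : Set T.root) = Set.range idx := Set.ext hsupp
    rw [hb, hη, ← hroot α, ← map_sub]
    exact hcl _ (hθ.2 _ (hF.root_mem hφ α))
  refine ⟨b, η, hhigh, ?_⟩
  obtain ⟨ν, hν0, hν1, hν2⟩ : ∃ ν : Option (Option (Fin r)) ≃ Option (Option b.support),
      ν none = none ∧ ν (some none) = some none ∧
        ∀ i, ν (some (some i)) = some (some (ν₀ i)) :=
    ⟨Equiv.optionCongr (Equiv.optionCongr ν₀), rfl, rfl, fun i => rfl⟩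
  have hp : ∀ {α β : T.root} {l m : Dual ℝ 𝔞}, (rootSystem T).root α = φ.dualMap l →
      (rootSystem T).root β = φ.dualMap m → ((rootSystem T).pairingIn ℤ β α : ℝ) =
        2 * dilatonProduct e l m / dilatonProduct e l l :=
    IsMaximalSplitSubalgebra.pairing_eq hφ hc
  refine isWeylChamberOf_dominantWall (instJ := _) h hσ hθ hn ν ?_
  rintro (_ | _ | i) (_ | _ | j) <;> simp only [hν0, hν1, hν2]
  · simp [KacMoody.lorentzianExtension, dominantWall, formProduct_symmetry_symmetry]
  · rw [formProduct_comm]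
    simp [KacMoody.lorentzianExtension, dominantWall, formProduct_symmetry_symmetry,
      formProduct_magnetic_symmetry]
  · rw [formProduct_comm]
    simp [KacMoody.lorentzianExtension, dominantWall, formProduct_electric_symmetry]
  · simp [KacMoody.lorentzianExtension, dominantWall, formProduct_magnetic_magnetic,
      formProduct_magnetic_symmetry, hn]
  · simp [KacMoody.lorentzianExtension, dominantWall, formProduct_magnetic_magnetic, hn,
      RootPairing.Base.untwistedAffine]
  · rw [formProduct_comm]
    simp only [KacMoody.lorentzianExtension, dominantWall, formProduct_magnetic_magnetic,
      RootPairing.Base.untwistedAffine, formProduct_electric_magnetic, Int.cast_neg, hν₀,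
      hp hη (hidx j), dilatonProduct_comm e (σ j) θ]
    ring
  · simp [KacMoody.lorentzianExtension, dominantWall, formProduct_electric_symmetry]
  · simp only [KacMoody.lorentzianExtension, dominantWall, formProduct_electric_electric,
      RootPairing.Base.untwistedAffine, formProduct_electric_magnetic, Int.cast_neg, hν₀,
      hp (hidx i) hη]
    ring
  · simp only [KacMoody.lorentzianExtension, dominantWall, formProduct_electric_electric,
      RootPairing.Base.untwistedAffine, hν₀, hp (hidx i) (hidx j)]

end MaximalSplit

/-! ### The theorem. -/

theorem mainTheorem1 {𝔤 : Type*} [LieRing 𝔤] [LieAlgebra ℝ 𝔤] [FiniteDimensional ℝ 𝔤]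
    [LieAlgebra.IsSimple ℝ 𝔤]
    (τ : 𝔤 ≃ₗ⁅ℝ⁆ 𝔤) (hτ : IsCartanInvolution τ)
    (𝔞 : Submodule ℝ 𝔤) (h𝔞 : IsMaximalAbelianNoncompact τ 𝔞)
    {r : ℕ} (σ : Fin r → Dual ℝ 𝔞) (hσ : IsSimpleSystem (restrictedRoots 𝔞) σ)
    (θ : Dual ℝ 𝔞) (hθ : IsHighestRoot (restrictedRoots 𝔞) σ θ)
    -- the dilatons are orthonormal coordinates for an invariant metric
    (e : Basis (Fin r) ℝ 𝔞)
    (he : ∃ c : ℝ, ∀ a b, c * killingForm ℝ 𝔤 (e a : 𝔤) (e b : 𝔤) = if a = b then 1 else 0)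
    (hnorm : formProduct e (dilatonForm θ) (dilatonForm θ) = 2) :
    -- the dominant walls cut out the billiard
    billiard σ = {x | ∀ i, 0 ≤ dominantWall σ θ i x} ∧
    -- (i)
    ((¬ ∃ n, IsOfBCType (restrictedRoots 𝔞) n) →
      ∀ (F : LieSubalgebra ℝ 𝔤) (T : LieSubalgebra ℝ F) [LieAlgebra.IsKilling ℝ F]
        [T.IsCartanSubalgebra] [LieModule.IsTriangularizable ℝ T F],
        IsMaximalSplitSubalgebra 𝔞 F T →
        IsWeylChamberOfOverextension e (billiard σ) (dominantWall σ θ)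
          (LieAlgebra.IsKilling.rootSystem T)) ∧
    -- (ii)
    (∀ n, IsOfBCType (restrictedRoots 𝔞) n →
      IsWeylChamberOf e (billiard σ) (dominantWall σ θ)
        (KacMoody.lorentzianExtension (twistedA2Even n) (Fin.last n))) := by
  obtain ⟨c, hc⟩ := he
  obtain ⟨b, rfl⟩ : ∃ b : Basis (Fin r) ℝ (Dual ℝ 𝔞), ⇑b = σ := by
    refine ⟨basisOfLinearIndependentOfCardEqFinrank' σ hσ.1 ?_,
      coe_basisOfLinearIndependentOfCardEqFinrank' _ _ _⟩
    rw [Subspace.dual_finrank_eq, finrank_eq_card_basis e]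
  have h := isRootSet_restrictedRoots hτ h𝔞 hc
  have hn : dilatonProduct e θ θ = 2 := (formProduct_electric_electric e θ θ).symm.trans hnorm
  have hbil := billiard_eq_dominantWall h hσ hθ
  refine ⟨hbil, fun hbc F T _ _ _ hF => ?_, fun n hbc => ?_⟩
  · rw [hbil]
    -- If `θ/2` were a restricted root, the system would be of type `bc_r`.
    refine hF.isWeylChamberOfOverextension hc h hσ hθ hn fun hdiv => hbc ⟨r, ?_⟩
    have hθε : (2 : ℝ) • ((1 / 2 : ℝ) • θ) = θ := by rw [smul_smul]; norm_num
    obtain ⟨u, -, hu, -⟩ := IsHighestRoot.exists_bc_basis (ε := (1 / 2 : ℝ) • θ) h hσ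
      (by rwa [hθε]) hdiv (by simp [hn])
    exact isOfBCType_of_basis hu
  · rw [hbil]
    exact isWeylChamberOf_of_isOfBCType h hσ hθ hn hbc

end
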